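/- **Setting.** An optimizer (rows, maximizer) and a learner (columns, minimizer) play a zero-sum game $A\in[-1,1]^{n\times m}$ of value $\mathrm{val}(A)=\max_{x}\min_{y}x^\top A y$, over the simplices $\Delta^n,\Delta^m$. The learner uses a separable regularizer $h(y)=\sum_{i=1}^m\theta(y_i)$, where $\theta$ is continuous and strongly convex on $[0,1]$ and $C^2$ on $(0,1)$ ($\theta'(0^+)=-\infty$ is allowed), and $h$ is $\alpha$-strongly convex on $\Delta^m$ with respect to a norm $\|\cdot\|$ on $\mathbb R^m$, $\alpha>0$. With step size $\eta$, the learner answers the plays $x(0),\dots,x(t-1)$ by $$y(t)=\operatorname*{argmax}_{y\in\Delta^m}\Big\{\Big\langle-\eta\sum_{\tau<t}A^\top x(\tau),\,y\Big\rangle-h(y)\Big\}.$$ The exploitation of $x(\cdot)$ over $t$ rounds is $\mathrm{Expl}^{(\eta,t)}(x)=\sum_{\tau<t}x(\tau)^\top A\,y(\tau)-t\,\mathrm{val}(A)$. Fix $\delta\in(0,1/m)$ and put $$\bar\eta=\frac{\alpha}{c\,\sup_{u\in[-1,1]^m}\|u\|_*}\Big(\frac1m-\delta\Big),\qquad c=\sup_{u\ne0}\frac{\|u\|_\infty}{\|u\|},\qquad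 M=\sup_{[\delta,1-\delta]}\theta''.$$ For $x\in\Delta^n$ let $\mathrm{BR}(x)=\operatorname{argmin}_j(A^\top x)_j$. Let $\mathcal E$ be the set of $A\in[-1,1]^{n\times m}$ such that any two entries in the same row differ by at least $2/(n^2m^3)$ and some max-min strategy $x^\star$ has two best responses $i,j\in\mathrm{BR}(x^\star)$ with $A_{\ell i}\ne A_{\ell j}$ for some $\ell$ with $x^\star_\ell>0$. For $A\in\mathcal E$ and such an $x^\star$, let $k=|\mathrm{BR}(x^\star)|$, and let $\mathrm{gap}_{\min},\mathrm{gap}_{\max}$ be the least and the largest value of $(A^\top x^\star)_j-\min_i(A^\top x^\star)_i$ over $j\notin\mathrm{BR}(x^\star)$. The accuracy of a play $x(\cdot)$ is $\mathrm{acc}_x(\eta,t)=\|y(t)-\mathrm{unif}(\mathrm{BR}(x^\star))\|_1$. The *price of precision* is $$\mathcal C(\gamma)=\inf_{(\eta,t)}\ \sup_{x(\cdot)}\big\{\mathrm{Expl}^{(\eta,t)}(x)\;:\;\mathrm{acc}_x(\eta,t)\le\gamma\big\},$$ where the infimum is over all $0<\eta\le\bar\eta$ and integers $t\ge2$ for which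 the constant play $x(\cdot)\equiv x^\star$ has accuracy $\mathrm{acc}_{x^\star}(\eta,t)\le\gamma$. Finally put $$C_A=\frac{1}{M n^6m^6}\cdot\frac{\mathrm{gap}_{\min}}{\mathrm{gap}_{\max}} .$$ **Theorem.** (a) If $A$ has i.i.d. entries uniform on $[-1,1]$, then $\Pr[A\in\mathcal E]\ge1-\frac{n!\,m!}{(n+m-1)!}-\frac1{nm}$. (b) For every $A\in\mathcal E$ and every such $x^\star$ with $k<m$, one has $\mathrm{gap}_{\min}>0$ and $C_A>0$, and for all $\gamma\in(0,2)$ $$\mathcal C(\gamma)\ \ge\ \frac{C_A}{2\,\mathrm{gap}_{\min}}\Big(\theta'\Big(\frac{1-\gamma/2}{k}\Big)-\theta'\Big(\frac{\gamma}{2(m-k)}\Big)\Big)$$ and $$\mathcal C(\gamma)\ \ge\ \frac{1}{2Mn^6m^6\,\mathrm{gap}_{\min}}\Big(\theta'\Big(\frac{1-\gamma/2}{k}\Big)-\theta'\Big(\frac{\gamma}{2}\Big)\Big).$$ Hence $\mathcal C(\gamma)=\Omega\big(\theta'(1/k)-\theta'(\gamma/(2(m-k)))\big)$ as $\gamma\to0^+$: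 there is a constant $c>0$, independent of $\gamma$, such that $\mathcal C(\gamma)\ge c\,\big(\theta'(1/k)-\theta'(\gamma/(2(m-k)))\big)$ for all sufficiently small $\gamma>0$. -/

import Mathlib

open Set Filter Topology MeasureTheory

/-- A kernel: continuous and strongly convex on `[0,1]`, twice continuously differentiable in the
interior.  No slope condition at `0` is imposed, so steep kernels (`θ'(0⁺) = -∞`) and non-steep
kernels are both allowed. -/
structure IsKernel (θ : ℝ → ℝ) : Prop where
  continuousOn : ContinuousOn θ (Icc 0 1)
  contDiffOn : ContDiffOn ℝ 2 θ (Ioo 0 1)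
  strongConvexOn : ∃ κ : ℝ, 0 < κ ∧ StrongConvexOn (Icc 0 1) κ θ

/-- The separable regularizer `h(y) = ∑ i, θ(y_i)` with kernel `θ`. -/
def sepReg {m : ℕ} (θ : ℝ → ℝ) (y : Fin m → ℝ) : ℝ := ∑ i, θ (y i)

/-- The FTRL choice map `Q_h(z) = argmax_{y ∈ Δ} (⟨z, y⟩ - h(y))`. -/
noncomputable def choiceMap {m : ℕ} (θ : ℝ → ℝ) (z : Fin m → ℝ) : Fin m → ℝ :=
  Classical.epsilon fun y : Fin m → ℝ =>
    y ∈ stdSimplex ℝ (Fin m) ∧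
      IsMaxOn (fun y : Fin m → ℝ => z ⬝ᵥ y - sepReg θ y) (stdSimplex ℝ (Fin m)) y

/-- The choice map really is a maximizer. -/
theorem choiceMap_spec {m : ℕ} (hm : 0 < m) {θ : ℝ → ℝ} (hθ : IsKernel θ) (z : Fin m → ℝ) :
    choiceMap θ z ∈ stdSimplex ℝ (Fin m) ∧
      IsMaxOn (fun y : Fin m → ℝ => z ⬝ᵥ y - sepReg θ y) (stdSimplex ℝ (Fin m))
        (choiceMap θ z) := by
  have : Nonempty (Fin m) := ⟨⟨0, hm⟩⟩
  have hc : ContinuousOn (fun y : Fin m → ℝ => z ⬝ᵥ y - sepReg θ y) (stdSimplex ℝ (Fin m)) := by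
    apply ContinuousOn.sub
    · unfold dotProduct
      fun_prop
    · unfold sepReg
      refine continuousOn_finsetSum _ fun i _ => ?_
      refine hθ.continuousOn.comp (continuous_apply i).continuousOn fun y hy => ?_
      exact mem_Icc_of_mem_stdSimplex hy i
  have hne : (stdSimplex ℝ (Fin m)).Nonempty :=
    ⟨_, single_mem_stdSimplex ℝ (⟨0, hm⟩ : Fin m)⟩
  obtain ⟨y, hy, hmax⟩ := (isCompact_stdSimplex ℝ (Fin m)).exists_isMaxOn hne hc
  exact Classical.epsilon_spec
    (p := fun y : Fin m → ℝ => y ∈ stdSimplex ℝ (Fin m) ∧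
      IsMaxOn (fun y : Fin m → ℝ => z ⬝ᵥ y - sepReg θ y) (stdSimplex ℝ (Fin m)) y) ⟨y, hy, hmax⟩

/-- `h` is `α`-strongly convex on the simplex with respect to the norm `N`. -/
def StronglyConvexWrt {m : ℕ} (N : Seminorm ℝ (Fin m → ℝ)) (α : ℝ) (h : (Fin m → ℝ) → ℝ) : Prop :=
  ∀ a ∈ stdSimplex ℝ (Fin m), ∀ b ∈ stdSimplex ℝ (Fin m), ∀ s t : ℝ, 0 ≤ s → 0 ≤ t → s + t = 1 →
    h (s • a + t • b) ≤ s * h a + t * h b - α / 2 * (s * t) * N (a - b) ^ 2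

/-- The dual norm of `N`. -/
noncomputable def dualNorm {m : ℕ} (N : Seminorm ℝ (Fin m → ℝ)) (z : Fin m → ℝ) : ℝ :=
  sSup ((fun u => z ⬝ᵥ u) '' {u : Fin m → ℝ | N u ≤ 1})

/-- `c_N = sup_{u ≠ 0} ‖u‖_∞ / N(u)`; the norm of `Fin m → ℝ` is the sup norm. -/
noncomputable def normConst {m : ℕ} (N : Seminorm ℝ (Fin m → ℝ)) : ℝ :=
  sSup ((fun u : Fin m → ℝ => ‖u‖ / N u) '' {u : Fin m → ℝ | u ≠ 0})

/-- The largest admissible step size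
`α / (c_N · sup_{u ∈ [-1,1]^m} N_*(u)) · (1/m - δ)`. -/
noncomputable def maxStep {m : ℕ} (N : Seminorm ℝ (Fin m → ℝ)) (α δ : ℝ) : ℝ :=
  α / (normConst N * sSup (dualNorm N '' {u : Fin m → ℝ | ∀ i, u i ∈ Icc (-1 : ℝ) 1})) *
    (1 / (m : ℝ) - δ)

section Game

variable {n m : ℕ}

/-- The value `max_x min_y xᵀ A y`: the optimizer (rows) maximizes, the learner (columns)
minimizes. -/
noncomputable def gameValue (A : Matrix (Fin n) (Fin m) ℝ) : ℝ :=
  ⨆ x : stdSimplex ℝ (Fin n), ⨅ y : stdSimplex ℝ (Fin m),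
    (x : Fin n → ℝ) ⬝ᵥ A.mulVec (y : Fin m → ℝ)

/-- `x` is a max-min strategy of the optimizer. -/
def IsMaxMin (A : Matrix (Fin n) (Fin m) ℝ) (x : Fin n → ℝ) : Prop :=
  x ∈ stdSimplex ℝ (Fin n) ∧ ∀ y ∈ stdSimplex ℝ (Fin m), gameValue A ≤ x ⬝ᵥ A.mulVec y

open Classical in
/-- The learner's pure best responses to `x`: the columns that minimize `xᵀ A e_i`. -/
noncomputable def bestResp (A : Matrix (Fin n) (Fin m) ℝ) (x : Fin n → ℝ) : Finset (Fin m) :=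
  Finset.univ.filter fun i => ∀ j, Matrix.vecMul x A i ≤ Matrix.vecMul x A j

/-- The suboptimality gap of column `i` against `x`. -/
noncomputable def gap (A : Matrix (Fin n) (Fin m) ℝ) (x : Fin n → ℝ) (i : Fin m) : ℝ :=
  Matrix.vecMul x A i - ⨅ j, Matrix.vecMul x A j

/-- The smallest gap of a column that is not a best response. -/
noncomputable def gapMin (A : Matrix (Fin n) (Fin m) ℝ) (x : Fin n → ℝ) : ℝ :=
  ⨅ i : {i : Fin m // i ∉ bestResp A x}, gap A x i

/-- The largest gap of a column that is not a best response. -/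
noncomputable def gapMax (A : Matrix (Fin n) (Fin m) ℝ) (x : Fin n → ℝ) : ℝ :=
  ⨆ i : {i : Fin m // i ∉ bestResp A x}, gap A x i

open Classical in
/-- The uniform distribution on the best responses to `x`. -/
noncomputable def uniformBestResp (A : Matrix (Fin n) (Fin m) ℝ) (x : Fin n → ℝ) : Fin m → ℝ :=
  fun j => if j ∈ bestResp A x then 1 / ((bestResp A x).card : ℝ) else 0

/-- Two best responses to `x` that do not coincide on the support of `x`. -/
def NonIdentified (A : Matrix (Fin n) (Fin m) ℝ) (x : Fin n → ℝ) : Prop :=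
  ∃ i ∈ bestResp A x, ∃ j ∈ bestResp A x, ∃ l, 0 < x l ∧ A l i ≠ A l j

/-- Any two entries in the same row differ by at least `2 / (n² m³)`. -/
def EntryGap (A : Matrix (Fin n) (Fin m) ℝ) : Prop :=
  ∀ l i j, i ≠ j → 2 / ((n : ℝ) ^ 2 * (m : ℝ) ^ 3) ≤ |A l i - A l j|

/-- The event on the payoff matrix: entries in `[-1,1]`, separated entries in each row, and some
max-min strategy with two best responses that do not coincide on its support. -/
def GoodGame (A : Matrix (Fin n) (Fin m) ℝ) : Prop :=
  (∀ i j, A i j ∈ Icc (-1 : ℝ) 1) ∧ EntryGap A ∧ ∃ x, IsMaxMin A x ∧ NonIdentified A x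

/-- The law of a payoff matrix with i.i.d. entries uniform on `[-1,1]`. -/
noncomputable def uniformGame (n m : ℕ) : Measure (Fin n → Fin m → ℝ) :=
  Measure.pi fun _ => Measure.pi fun _ => ProbabilityTheory.cond volume (Icc (-1 : ℝ) 1)

/-- The learner's FTRL strategy in round `t` with step size `η`, started from zero, after the
optimizer has played `x 0, …, x (t-1)`; the learner's payoff matrix is `-A`. -/
noncomputable def response (θ : ℝ → ℝ) (A : Matrix (Fin n) (Fin m) ℝ) (η : ℝ)
    (x : ℕ → stdSimplex ℝ (Fin n)) (t : ℕ) : Fin m → ℝ :=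
  choiceMap θ (η • ∑ τ ∈ Finset.range t, Matrix.vecMul (x τ : Fin n → ℝ) (-A))

/-- The exploitation over `t` rounds: the optimizer's total reward minus `t` times the value. -/
noncomputable def exploitation (θ : ℝ → ℝ) (A : Matrix (Fin n) (Fin m) ℝ) (η : ℝ)
    (x : ℕ → stdSimplex ℝ (Fin n)) (t : ℕ) : ℝ :=
  ∑ τ ∈ Finset.range t, (x τ : Fin n → ℝ) ⬝ᵥ A.mulVec (response θ A η x τ) - t * gameValue A

/-- The `ℓ¹` distance, after `t` rounds of the play `x`, of the learner's strategy from the uniform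
best response to `xs`. -/
noncomputable def accuracy (θ : ℝ → ℝ) (A : Matrix (Fin n) (Fin m) ℝ) (xs : Fin n → ℝ) (η : ℝ)
    (x : ℕ → stdSimplex ℝ (Fin n)) (t : ℕ) : ℝ :=
  ∑ j, |response θ A η x t j - uniformBestResp A xs j|

/-- The price of precision at accuracy `γ`: the infimum, over the step sizes `0 < η ≤ ηmax` and
horizons `t ≥ 2` for which the learner is `γ`-accurate against the fixed strategy `xs`, of the
supremum of the exploitation over all plays of the optimizer at whose end the learner is
`γ`-accurate. -/
noncomputable def priceOfPrecision (θ : ℝ → ℝ) (A : Matrix (Fin n) (Fin m) ℝ)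
    (xs : stdSimplex ℝ (Fin n)) (ηmax γ : ℝ) : EReal :=
  ⨅ (η : ℝ) (t : ℕ) (_ : 0 < η ∧ η ≤ ηmax ∧ 2 ≤ t ∧ accuracy θ A xs η (fun _ => xs) t ≤ γ),
    ⨆ (x : ℕ → stdSimplex ℝ (Fin n)) (_ : accuracy θ A xs η x t ≤ γ),
      ((exploitation θ A η x t : ℝ) : EReal)

/-- The exploitation rate `1 / (M n⁶ m⁶)` with `M = sup_{[δ, 1-δ]} θ''`. -/
noncomputable def exploitRate (n m : ℕ) (θ : ℝ → ℝ) (δ : ℝ) : ℝ :=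
  1 / (sSup (deriv (deriv θ) '' Icc δ (1 - δ)) * (n : ℝ) ^ 6 * (m : ℝ) ^ 6)

/-- The game-dependent constant `C_A`: the exploitation rate times `gap_min / gap_max`. -/
noncomputable def gameConst (θ : ℝ → ℝ) (A : Matrix (Fin n) (Fin m) ℝ) (xs : Fin n → ℝ)
    (δ : ℝ) : ℝ :=
  exploitRate n m θ δ * (gapMin A xs / gapMax A xs)

end Game

/-! Lower bound. Let `i ≠ j` be two best responses to the max-min strategy `xs`. The exploiting play
alternates `xs + d` and `xs - d`. Each pair of rounds adds up to two rounds of `xs`, so after every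
pair the cumulative payoff lies on the ray of the constant play, and the final response, hence the
accuracy, is unchanged. If `y`, `y'` are the learner's responses inside a pair and `w = xs + d`, the
pair earns, above twice the value, `2 (xsᵀ A y' - val) + ⟨-Aᵀ w, y' - y⟩`. The first term is
nonnegative since `xs` is max-min. The second is a monotonicity gap of the choice map: it dominates
the contributions of columns `i` and `j`, where `θ'` is increasing and `M`-Lipschitz, while the
first-order conditions fix the relative movement of `θ'` at `i` and `j` as `-η ((Aᵀ w)_i - (Aᵀ
w)_j)`. This gives a gain of order `η / M` per pair (`IsChoice.sq_sub_le_dotProduct`,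
`exists_exploiting_play`). The bound on the step size keeps these two coordinates in `[δ, 1 - δ]`,
and the separation of entries supplies a direction `d` that tells `i` from `j` (`exists_direction`).

The exploitation is thus at least a constant times `η t`. Conversely, accuracy against the constant
play forces `η t` to be large: a column outside the best responses must have little mass, and the
first-order condition turns this into a lower bound on `η t` times its gap
(`IsChoice.deriv_sub_le_mul_gap`).

Probability. If a max-min strategy has a unique best response and columns have no ties, there is a
pure saddle point (`exists_saddle_of_unique_bestResp`). Saddle points are counted by a beta integral
(`uniformGame_saddle`), close entries by a union bound over pairs in a row. -/

/-! ### Convexity and smoothness of kernels -/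

namespace IsKernel

variable {θ : ℝ → ℝ} (hθ : IsKernel θ)
include hθ

theorem strictConvexOn : StrictConvexOn ℝ (Icc 0 1) θ := by
  obtain ⟨κ, hκ, h⟩ := hθ.strongConvexOn
  exact h.strictConvexOn hκ

theorem differentiableAt {x : ℝ} (hx : x ∈ Ioo (0 : ℝ) 1) : DifferentiableAt ℝ θ x :=
  (hθ.contDiffOn.differentiableOn (by norm_num)).differentiableAt (isOpen_Ioo.mem_nhds hx)

theorem contDiffOn_deriv : ContDiffOn ℝ 1 (deriv θ) (Ioo 0 1) :=
  ((contDiffOn_succ_iff_deriv_of_isOpen (n := 1) isOpen_Ioo).1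
    (by simpa [one_add_one_eq_two] using hθ.contDiffOn)).2.2

theorem continuousAt_deriv {x : ℝ} (hx : x ∈ Ioo (0 : ℝ) 1) : ContinuousAt (deriv θ) x :=
  hθ.contDiffOn_deriv.continuousOn.continuousAt (isOpen_Ioo.mem_nhds hx)

theorem differentiableAt_deriv {x : ℝ} (hx : x ∈ Ioo (0 : ℝ) 1) :
    DifferentiableAt ℝ (deriv θ) x :=
  (hθ.contDiffOn_deriv.differentiableOn (by norm_num)).differentiableAt (isOpen_Ioo.mem_nhds hx)

theorem continuousOn_deriv_deriv : ContinuousOn (deriv (deriv θ)) (Ioo 0 1) :=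
  hθ.contDiffOn_deriv.continuousOn_deriv_of_isOpen isOpen_Ioo le_rfl

theorem strictMonoOn_deriv : StrictMonoOn (deriv θ) (Ioo 0 1) :=
  (hθ.strictConvexOn.subset Ioo_subset_Icc_self (convex_Ioo 0 1)).strictMonoOn_deriv
    fun _ hx => hθ.differentiableAt hx

/-- The graph of a kernel lies above its tangents. -/
theorem tangent_le {x y : ℝ} (hx : x ∈ Ioo (0 : ℝ) 1) (hy : y ∈ Icc (0 : ℝ) 1) :
    deriv θ x * (y - x) ≤ θ y - θ x := by
  have hx' := Ioo_subset_Icc_self hx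
  rcases lt_trichotomy x y with h | h | h
  · have := hθ.strictConvexOn.convexOn.le_slope_of_hasDerivAt hx' hy h
      (hθ.differentiableAt hx).hasDerivAt
    rw [slope_def_field, le_div_iff₀ (by linarith)] at this
    exact this
  · simp [h]
  · have := hθ.strictConvexOn.convexOn.slope_le_of_hasDerivAt hy hx' h
      (hθ.differentiableAt hx).hasDerivAt
    rw [slope_def_field, div_le_iff₀ (by linarith)] at this
    linarith

theorem bddAbove_deriv_deriv {δ : ℝ} (hδ : 0 < δ) :
    BddAbove (deriv (deriv θ) '' Icc δ (1 - δ)) :=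
  (isCompact_Icc.image_of_continuousOn (hθ.continuousOn_deriv_deriv.mono
    fun x hx => ⟨by linarith [hx.1], by linarith [hx.2]⟩)).bddAbove

theorem deriv_sub_le {δ : ℝ} (hδ : 0 < δ) {u v : ℝ} (hu : u ∈ Icc δ (1 - δ))
    (hv : v ∈ Icc δ (1 - δ)) (huv : u ≤ v) :
    deriv θ v - deriv θ u ≤ sSup (deriv (deriv θ) '' Icc δ (1 - δ)) * (v - u) := by
  have hsub : Icc δ (1 - δ) ⊆ Ioo (0 : ℝ) 1 :=
    fun x hx => ⟨by linarith [hx.1], by linarith [hx.2]⟩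
  refine (convex_Icc δ (1 - δ)).image_sub_le_mul_sub_of_deriv_le
    (hθ.contDiffOn_deriv.continuousOn.mono hsub)
    (fun x hx => (hθ.differentiableAt_deriv (hsub (interior_subset hx))).differentiableWithinAt)
    (fun x hx => le_csSup (hθ.bddAbove_deriv_deriv hδ) (mem_image_of_mem _ (interior_subset hx)))
    u hu v hv huv

/-- `θ'` strictly increases over an interval of positive length, which a nonpositive bound on `θ''`
would forbid. -/
theorem sSup_deriv_deriv_pos {δ : ℝ} (hδ : 0 < δ) (hδ' : δ < 1 / 2) :
    0 < sSup (deriv (deriv θ) '' Icc δ (1 - δ)) := by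
  have h := hθ.deriv_sub_le hδ (u := δ) (v := 1 - δ) ⟨le_rfl, by linarith⟩
    ⟨by linarith, le_rfl⟩ (by linarith)
  have h' := hθ.strictMonoOn_deriv (a := δ) (b := 1 - δ) ⟨hδ, by linarith⟩
    ⟨by linarith, by linarith⟩ (by linarith)
  by_contra! hc
  nlinarith

/-- Co-coercivity: an increasing `M`-Lipschitz function moves by at most `M` times its argument, in
the same direction. It converts movement of `θ'` into a monotonicity gap. -/
theorem sq_deriv_sub_le {δ : ℝ} (hδ : 0 < δ) {u v : ℝ} (hu : u ∈ Icc δ (1 - δ))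
    (hv : v ∈ Icc δ (1 - δ)) :
    (deriv θ v - deriv θ u) ^ 2 ≤
      sSup (deriv (deriv θ) '' Icc δ (1 - δ)) * ((deriv θ v - deriv θ u) * (v - u)) := by
  have hsub : Icc δ (1 - δ) ⊆ Ioo (0 : ℝ) 1 :=
    fun x hx => ⟨by linarith [hx.1], by linarith [hx.2]⟩
  wlog huv : u ≤ v generalizing u v
  · have := this hv hu (by linarith)
    linarith
  have h := hθ.deriv_sub_le hδ hu hv huv
  have h' := hθ.strictMonoOn_deriv.monotoneOn (hsub hu) (hsub hv) huv
  nlinarith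

end IsKernel

/-! ### Optimality conditions and monotonicity of the choice map -/

/-- `y` maximizes `⟨z, ·⟩ - h` on the simplex. -/
def IsChoice {m : ℕ} (θ : ℝ → ℝ) (z y : Fin m → ℝ) : Prop :=
  y ∈ stdSimplex ℝ (Fin m) ∧
    ∀ w ∈ stdSimplex ℝ (Fin m), z ⬝ᵥ w - sepReg θ w ≤ z ⬝ᵥ y - sepReg θ y

theorem isChoice_choiceMap {m : ℕ} (hm : 0 < m) {θ : ℝ → ℝ} (hθ : IsKernel θ) (z : Fin m → ℝ) :
    IsChoice θ z (choiceMap θ z) :=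
  ⟨(choiceMap_spec hm hθ z).1, fun _ hw => (choiceMap_spec hm hθ z).2 hw⟩

namespace IsChoice

variable {m : ℕ} {θ : ℝ → ℝ} {z y z' y' : Fin m → ℝ}

/-- Moving mass `s` from coordinate `i` to coordinate `j` does not improve the choice. -/
theorem mul_sub_le (hy : IsChoice θ z y) {i j : Fin m} (hij : i ≠ j) {s : ℝ} (hs : 0 ≤ s)
    (hsi : s ≤ y i) :
    s * (z j - z i) ≤ (θ (y j + s) - θ (y j)) + (θ (y i - s) - θ (y i)) := by
  have hw : y + (Pi.single j s - Pi.single i s) ∈ stdSimplex ℝ (Fin m) := by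
    refine ⟨fun l => ?_, ?_⟩
    · have := hy.1.1 l
      rcases eq_or_ne l j with rfl | h1
      · simp [hij.symm]; linarith
      · rcases eq_or_ne l i with rfl | h2
        · simp [h1]; linarith
        · simp [h1, h2, this]
    · simp [Finset.sum_add_distrib, hy.1.2]
  have h := hy.2 _ hw
  have e1 : z ⬝ᵥ (y + (Pi.single j s - Pi.single i s)) = z ⬝ᵥ y + s * (z j - z i) := by
    simp [dotProduct_add, dotProduct_sub]; ring
  have e2 : sepReg θ (y + (Pi.single j s - Pi.single i s)) - sepReg θ y =
      (θ (y j + s) - θ (y j)) + (θ (y i - s) - θ (y i)) := by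
    unfold sepReg
    rw [← Finset.sum_sub_distrib, Fintype.sum_eq_add j i hij.symm]
    · simp [hij, hij.symm, sub_eq_add_neg]
    · rintro l ⟨h1, h2⟩
      simp [h1, h2]
  linarith

/-- The first-order condition, for levels `p ≤ y i` and `y j ≤ q` in the interior. -/
theorem deriv_sub_deriv_le (hθ : IsKernel θ) (hy : IsChoice θ z y) {i j : Fin m} (hij : i ≠ j)
    {p q : ℝ} (hp : p ∈ Ioo (0 : ℝ) 1) (hq : q ∈ Ioo (0 : ℝ) 1) (hpi : p ≤ y i) (hjq : y j ≤ q) :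
    deriv θ p - deriv θ q ≤ z i - z j := by
  -- The coordinates may lie on the boundary, where `θ'` need not exist. After mass `s` has moved,
  -- both affected coordinates are interior, so tangents there apply; monotonicity of `θ'` passes to
  -- `p - s` and `q + s`, and `s → 0` concludes.
  have hlim : Tendsto (fun s : ℝ => deriv θ (p - s) - deriv θ (q + s)) (𝓝[>] 0)
      (𝓝 (deriv θ p - deriv θ q)) := by
    have h1 : Tendsto (fun s : ℝ => p - s) (𝓝[>] 0) (𝓝 p) := by
      have : Tendsto (fun s : ℝ => p - s) (𝓝 0) (𝓝 (p - 0)) :=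
        (continuous_const.sub continuous_id).tendsto 0
      rw [sub_zero] at this
      exact this.mono_left nhdsWithin_le_nhds
    have h2 : Tendsto (fun s : ℝ => q + s) (𝓝[>] 0) (𝓝 q) := by
      have : Tendsto (fun s : ℝ => q + s) (𝓝 0) (𝓝 (q + 0)) :=
        (continuous_const.add continuous_id).tendsto 0
      rw [add_zero] at this
      exact this.mono_left nhdsWithin_le_nhds
    exact ((hθ.continuousAt_deriv hp).tendsto.comp h1).sub
      ((hθ.continuousAt_deriv hq).tendsto.comp h2)
  refine le_of_tendsto hlim ?_
  have hpos : 0 < min p (1 - q) := lt_min hp.1 (by linarith [hq.2])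
  filter_upwards [Ioo_mem_nhdsGT hpos] with s hs
  obtain ⟨hs0, hs1⟩ := hs
  have hs2 := lt_min_iff.1 hs1
  have hi1 := (mem_Icc_of_mem_stdSimplex hy.1 i)
  have hj1 := (mem_Icc_of_mem_stdSimplex hy.1 j)
  have hsum : y i + y j ≤ 1 := by
    rw [← hy.1.2, ← Finset.sum_pair hij]
    exact Finset.sum_le_sum_of_subset_of_nonneg (Finset.subset_univ _) fun l _ _ => hy.1.1 l
  have mi : y i - s ∈ Ioo (0 : ℝ) 1 := ⟨by linarith, by linarith [hi1.2]⟩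
  have mj : y j + s ∈ Ioo (0 : ℝ) 1 := ⟨by linarith [hj1.1], by linarith⟩
  have h := hy.mul_sub_le hij hs0.le (by linarith)
  have t1 := hθ.tangent_le mi hi1
  have t2 := hθ.tangent_le mj hj1
  have m1 := hθ.strictMonoOn_deriv.monotoneOn (a := p - s) (b := y i - s)
    ⟨by linarith, by linarith [hp.2]⟩ mi (by linarith)
  have m2 := hθ.strictMonoOn_deriv.monotoneOn (a := y j + s) (b := q + s) mj
    ⟨by linarith [hq.1], by linarith⟩ (by linarith)
  have : s * (z j - z i) ≤ s * (deriv θ (y j + s) - deriv θ (y i - s)) := by nlinarith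
  have := le_of_mul_le_mul_left this hs0
  linarith

theorem deriv_sub_deriv_eq (hθ : IsKernel θ) (hy : IsChoice θ z y) {i j : Fin m}
    (hi : y i ∈ Ioo (0 : ℝ) 1) (hj : y j ∈ Ioo (0 : ℝ) 1) :
    deriv θ (y i) - deriv θ (y j) = z i - z j := by
  rcases eq_or_ne i j with rfl | hij
  · simp
  have h1 := hy.deriv_sub_deriv_le hθ hij hi hj le_rfl le_rfl
  have h2 := hy.deriv_sub_deriv_le hθ hij.symm hj hi le_rfl le_rfl
  linarith

/-- If the masses were in the opposite strict order, two interior levels between them would violate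
the first-order condition, by strict monotonicity of `θ'`. Interior levels make this work for
boundary coordinates too. -/
theorem le_of_le (hθ : IsKernel θ) (hy : IsChoice θ z y) {i j : Fin m} (hz : z i ≤ z j) :
    y i ≤ y j := by
  by_contra! h
  have hij : i ≠ j := by rintro rfl; exact lt_irrefl _ h
  obtain ⟨q, hq1, hq2⟩ := exists_between h
  obtain ⟨p, hp1, hp2⟩ := exists_between hq2
  have hi := mem_Icc_of_mem_stdSimplex hy.1 i
  have hj := mem_Icc_of_mem_stdSimplex hy.1 j
  have mp : p ∈ Ioo (0 : ℝ) 1 := ⟨by linarith [hj.1], by linarith [hi.2]⟩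
  have mq : q ∈ Ioo (0 : ℝ) 1 := ⟨by linarith [hj.1], by linarith [hi.2]⟩
  have h1 := hy.deriv_sub_deriv_le hθ hij mp mq hp2.le hq1.le
  have h2 := hθ.strictMonoOn_deriv mq mp hp1
  linarith

/-- Monotonicity of the choice map, with the contribution of the coordinates in `S` that stay in
the interior made explicit. -/
theorem sum_deriv_sub_mul_le (hθ : IsKernel θ) (hy : IsChoice θ z y) (hy' : IsChoice θ z' y')
    (S : Finset (Fin m)) (hS : ∀ i ∈ S, y i ∈ Ioo (0 : ℝ) 1 ∧ y' i ∈ Ioo (0 : ℝ) 1) :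
    ∑ i ∈ S, (deriv θ (y' i) - deriv θ (y i)) * (y' i - y i) ≤ (z' - z) ⬝ᵥ (y' - y) := by
  have hlim : Tendsto (fun s : ℝ => ∑ i ∈ S,
      (deriv θ (y' i - s * (y' i - y i)) - deriv θ (y i + s * (y' i - y i))) * (y' i - y i))
      (𝓝[>] 0) (𝓝 (∑ i ∈ S, (deriv θ (y' i) - deriv θ (y i)) * (y' i - y i))) := by
    refine tendsto_finsetSum _ fun i hi => Tendsto.mul_const _ (Tendsto.sub ?_ ?_)
    · refine (hθ.continuousAt_deriv (hS i hi).2).tendsto.comp ?_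
      have : Tendsto (fun s : ℝ => y' i - s * (y' i - y i)) (𝓝 0)
          (𝓝 (y' i - 0 * (y' i - y i))) := Continuous.tendsto (by fun_prop) 0
      rw [zero_mul, sub_zero] at this
      exact this.mono_left nhdsWithin_le_nhds
    · refine (hθ.continuousAt_deriv (hS i hi).1).tendsto.comp ?_
      have : Tendsto (fun s : ℝ => y i + s * (y' i - y i)) (𝓝 0)
          (𝓝 (y i + 0 * (y' i - y i))) := Continuous.tendsto (by fun_prop) 0
      rw [zero_mul, add_zero] at this
      exact this.mono_left nhdsWithin_le_nhds
  refine le_of_tendsto hlim ?_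
  filter_upwards [Ioo_mem_nhdsGT (zero_lt_one (α := ℝ))] with s hs
  obtain ⟨hs0, hs1⟩ := hs
  have hw := convex_stdSimplex ℝ (Fin m) hy.1 hy'.1 (a := 1 - s) (b := s) (by linarith) hs0.le
    (by ring)
  have hw' := convex_stdSimplex ℝ (Fin m) hy.1 hy'.1 (a := s) (b := 1 - s) hs0.le (by linarith)
    (by ring)
  have h1 := hy.2 _ hw
  have h2 := hy'.2 _ hw'
  -- Each choice is tested against the point a fraction `s` of the way to the other one. In the sum
  -- of the two inequalities every coordinate contributes a nonnegative convexity defect; only those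
  -- in `S` are bounded further, by tangents at the intermediate points. Dividing by `s` and letting
  -- `s → 0` gives the claim.
  have e1 : s * ((z' - z) ⬝ᵥ (y' - y)) =
      z ⬝ᵥ y - z ⬝ᵥ ((1 - s) • y + s • y') + (z' ⬝ᵥ y' - z' ⬝ᵥ (s • y + (1 - s) • y')) := by
    simp only [dotProduct_add, dotProduct_sub, sub_dotProduct, dotProduct_smul, smul_eq_mul]
    ring
  have e2 : sepReg θ y + sepReg θ y' - sepReg θ ((1 - s) • y + s • y')
      - sepReg θ (s • y + (1 - s) • y') = ∑ i, (θ (y i) + θ (y' i)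
        - θ ((1 - s) * y i + s * y' i) - θ (s * y i + (1 - s) * y' i)) := by
    simp [sepReg, Finset.sum_sub_distrib, Finset.sum_add_distrib]
  have hterm : ∀ i, 0 ≤ θ (y i) + θ (y' i)
        - θ ((1 - s) * y i + s * y' i) - θ (s * y i + (1 - s) * y' i) := by
    intro i
    have hi := mem_Icc_of_mem_stdSimplex hy.1 i
    have hi' := mem_Icc_of_mem_stdSimplex hy'.1 i
    have c1 := hθ.strictConvexOn.convexOn.2 hi hi' (by linarith : 0 ≤ 1 - s) hs0.le (by ring)
    have c2 := hθ.strictConvexOn.convexOn.2 hi hi' hs0.le (by linarith : 0 ≤ 1 - s) (by ring)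
    simp only [smul_eq_mul] at c1 c2
    linarith
  have hS' : s * ∑ i ∈ S, (deriv θ (y' i - s * (y' i - y i)) - deriv θ (y i + s * (y' i - y i)))
      * (y' i - y i) ≤ ∑ i ∈ S, (θ (y i) + θ (y' i)
        - θ ((1 - s) * y i + s * y' i) - θ (s * y i + (1 - s) * y' i)) := by
    rw [Finset.mul_sum]
    refine Finset.sum_le_sum fun i hi => ?_
    obtain ⟨⟨a1, a2⟩, b1, b2⟩ := hS i hi
    have m1 : y' i - s * (y' i - y i) ∈ Ioo (0 : ℝ) 1 := ⟨by nlinarith, by nlinarith⟩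
    have m2 : y i + s * (y' i - y i) ∈ Ioo (0 : ℝ) 1 := ⟨by nlinarith, by nlinarith⟩
    have t1 := hθ.tangent_le m1 (Ioo_subset_Icc_self (hS i hi).2)
    have t2 := hθ.tangent_le m2 (Ioo_subset_Icc_self (hS i hi).1)
    have r1 : (1 - s) * y i + s * y' i = y i + s * (y' i - y i) := by ring
    have r2 : s * y i + (1 - s) * y' i = y' i - s * (y' i - y i) := by ring
    rw [r1, r2]
    linarith
  have hsub := Finset.sum_le_sum_of_subset_of_nonneg (Finset.subset_univ S)
    (fun i _ _ => hterm i)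
  refine le_of_mul_le_mul_left (a := s) ?_ hs0
  linarith

end IsChoice

/-! ### Comparison of norms and stability of the choice map -/

section Norms

variable {m : ℕ} {N : Seminorm ℝ (Fin m → ℝ)}

theorem Seminorm.continuous_pi_fin (N : Seminorm ℝ (Fin m → ℝ)) : Continuous N := by
  obtain ⟨C, hC⟩ : ∃ C : NNReal, (C : ℝ) = ∑ i : Fin m, N (Pi.single i 1) :=
    ⟨_, Real.coe_toNNReal _ (Finset.sum_nonneg fun i _ => apply_nonneg N _)⟩
  refine Seminorm.continuous_of_le (q := C • normSeminorm ℝ (Fin m → ℝ))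
    (continuous_norm.const_smul C) fun u => ?_
  change N u ≤ C * ‖u‖
  conv_lhs => rw [pi_eq_sum_univ' u]
  refine (Finset.le_sum_of_subadditive N (map_zero N).le (map_add_le_add N) _ _).trans ?_
  rw [hC, Finset.sum_mul]
  refine Finset.sum_le_sum fun i _ => ?_
  have e : (fun j => if j = i then (1 : ℝ) else 0) = Pi.single i 1 := by
    ext j; simp [Pi.single_apply]
  rw [map_smul_eq_mul, mul_comm]
  exact mul_le_mul_of_nonneg_left (norm_le_pi_norm u i) (apply_nonneg N _)

/-- Compactness of the unit sphere: `N` has a positive minimum there. This bounds the sets whose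
suprema define `normConst` and `dualNorm`, so that `sSup` is not its default value `0`. -/
theorem Seminorm.exists_norm_le_mul (hN : ∀ u, N u = 0 → u = 0) :
    ∃ C : ℝ, 0 < C ∧ ∀ u, ‖u‖ ≤ C * N u := by
  rcases isEmpty_or_nonempty (Fin m) with hm | hm
  · exact ⟨1, one_pos, fun u => by simp [Subsingleton.elim u 0]⟩
  obtain ⟨v, hv, hmin⟩ := (isCompact_sphere (0 : Fin m → ℝ) 1).exists_isMinOn
    (NormedSpace.sphere_nonempty.2 zero_le_one) N.continuous_pi_fin.continuousOn
  have hv1 : ‖v‖ = 1 := by simpa using hv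
  have hpos : 0 < N v := by
    refine lt_of_le_of_ne (apply_nonneg N v) fun h => ?_
    rw [hN v h.symm, norm_zero] at hv1
    exact zero_ne_one hv1
  refine ⟨(N v)⁻¹, inv_pos.2 hpos, fun u => ?_⟩
  rcases eq_or_ne u 0 with rfl | hu
  · simp
  have hu' : 0 < ‖u‖ := norm_pos_iff.2 hu
  have h : N v ≤ N (‖u‖⁻¹ • u) := hmin (by
    simp [norm_smul, hu'.ne'])
  rw [map_smul_eq_mul, norm_inv, norm_norm, ← div_eq_inv_mul, le_div_iff₀ hu'] at h
  rw [← div_eq_inv_mul, le_div_iff₀ hpos]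
  linarith

theorem norm_le_normConst_mul (hN : ∀ u, N u = 0 → u = 0) (u : Fin m → ℝ) :
    ‖u‖ ≤ normConst N * N u := by
  rcases eq_or_ne u 0 with rfl | hu
  · simp
  obtain ⟨C, hC, h⟩ := Seminorm.exists_norm_le_mul hN
  have hpos : ∀ u, u ≠ 0 → 0 < N u := fun u hu =>
    lt_of_le_of_ne (apply_nonneg N u) fun h => hu (hN u h.symm)
  rw [← div_le_iff₀ (hpos u hu)]
  refine le_csSup ⟨C, ?_⟩ ⟨u, hu, rfl⟩
  rintro _ ⟨w, hw, rfl⟩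
  exact (div_le_iff₀ (hpos w hw)).2 (h w)

theorem dotProduct_le_card_mul_norm (z u : Fin m → ℝ) : z ⬝ᵥ u ≤ m * (‖z‖ * ‖u‖) := by
  calc z ⬝ᵥ u ≤ ∑ _i : Fin m, ‖z‖ * ‖u‖ := Finset.sum_le_sum fun i _ => by
        refine (le_abs_self _).trans ?_
        rw [abs_mul]
        exact mul_le_mul (norm_le_pi_norm z i) (norm_le_pi_norm u i) (abs_nonneg _)
          (norm_nonneg _)
    _ = m * (‖z‖ * ‖u‖) := by simp

theorem exists_dotProduct_le (hN : ∀ u, N u = 0 → u = 0) :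
    ∃ C : ℝ, 0 ≤ C ∧ ∀ z u, N u ≤ 1 → z ⬝ᵥ u ≤ C * ‖z‖ := by
  obtain ⟨C, hC, h⟩ := Seminorm.exists_norm_le_mul hN
  refine ⟨m * C, by positivity, fun z u hu => (dotProduct_le_card_mul_norm z u).trans ?_⟩
  have : ‖u‖ ≤ C := (h u).trans (by nlinarith)
  have := mul_le_mul_of_nonneg_left this (norm_nonneg z)
  have := mul_le_mul_of_nonneg_left this (Nat.cast_nonneg (α := ℝ) m)
  linarith

theorem dotProduct_le_dualNorm_mul (hN : ∀ u, N u = 0 → u = 0) (z u : Fin m → ℝ) :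
    z ⬝ᵥ u ≤ dualNorm N z * N u := by
  rcases eq_or_ne u 0 with rfl | hu
  · simp
  have hpos : 0 < N u := lt_of_le_of_ne (apply_nonneg N u) fun h => hu (hN u h.symm)
  obtain ⟨C, -, h⟩ := exists_dotProduct_le hN
  have : z ⬝ᵥ ((N u)⁻¹ • u) ≤ dualNorm N z := by
    refine le_csSup ⟨C * ‖z‖, ?_⟩ ⟨_, ?_, rfl⟩
    · rintro _ ⟨w, hw, rfl⟩
      exact h z w hw
    · simp [map_smul_eq_mul, abs_of_pos hpos, hpos.ne']
  rwa [dotProduct_smul, smul_eq_mul, ← div_eq_inv_mul, div_le_iff₀ hpos] at this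

theorem dualNorm_le_sSup_cube (hN : ∀ u, N u = 0 → u = 0) {z : Fin m → ℝ}
    (hz : ∀ i, z i ∈ Icc (-1 : ℝ) 1) :
    dualNorm N z ≤ sSup (dualNorm N '' {u : Fin m → ℝ | ∀ i, u i ∈ Icc (-1 : ℝ) 1}) := by
  obtain ⟨C, hC, h⟩ := exists_dotProduct_le hN
  refine le_csSup ⟨C, ?_⟩ ⟨z, hz, rfl⟩
  rintro _ ⟨w, hw, rfl⟩
  refine csSup_le ⟨0, 0, by simp⟩ ?_
  rintro _ ⟨u, hu, rfl⟩
  have hw1 : ‖w‖ ≤ 1 := (pi_norm_le_iff_of_nonneg zero_le_one).2 fun i => abs_le.2 (hw i)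
  exact (h w u hu).trans (by nlinarith)

/-- Strong convexity of the regularizer at a choice. -/
theorem IsChoice.strong_le {θ : ℝ → ℝ} {α : ℝ} {z y w : Fin m → ℝ}
    (hs : StronglyConvexWrt N α (sepReg θ)) (hy : IsChoice θ z y)
    (hw : w ∈ stdSimplex ℝ (Fin m)) :
    z ⬝ᵥ w - sepReg θ w + α / 2 * N (w - y) ^ 2 ≤ z ⬝ᵥ y - sepReg θ y := by
  have key : ∀ s ∈ Ioo (0 : ℝ) 1,
      z ⬝ᵥ w - sepReg θ w + α / 2 * (1 - s) * N (w - y) ^ 2 ≤ z ⬝ᵥ y - sepReg θ y := by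
    intro s ⟨h0, h1⟩
    have c := hs w hw y hy.1 s (1 - s) h0.le (by linarith) (by ring)
    have o := hy.2 _ (convex_stdSimplex ℝ (Fin m) hw hy.1 h0.le
      (by linarith : 0 ≤ 1 - s) (by ring))
    simp only [dotProduct_add, dotProduct_smul, smul_eq_mul] at o
    refine le_of_mul_le_mul_left (a := s) ?_ h0
    linarith
  have hlim : Tendsto (fun s : ℝ => z ⬝ᵥ w - sepReg θ w + α / 2 * (1 - s) * N (w - y) ^ 2)
      (𝓝[>] 0) (𝓝 (z ⬝ᵥ w - sepReg θ w + α / 2 * (1 - 0) * N (w - y) ^ 2)) :=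
    (Continuous.tendsto (by fun_prop) 0).mono_left nhdsWithin_le_nhds
  rw [sub_zero, mul_one] at hlim
  refine le_of_tendsto hlim ?_
  filter_upwards [Ioo_mem_nhdsGT (zero_lt_one (α := ℝ))] with s hs using key s hs

/-- The choice map moves by at most `1/m - δ` in the sup norm for admissible step sizes. -/
theorem IsChoice.norm_sub_le_of_le_maxStep (hN : ∀ u, N u = 0 → u = 0) {θ : ℝ → ℝ} {α δ η : ℝ}
    (hα : 0 < α) (hs : StronglyConvexWrt N α (sepReg θ)) (hη : 0 < η) (hη' : η ≤ maxStep N α δ)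
    {z z' y y' u : Fin m → ℝ} (hy : IsChoice θ z y) (hy' : IsChoice θ z' y')
    (hu : ∀ i, u i ∈ Icc (-1 : ℝ) 1) (hz : z' - z = η • u) :
    ‖y' - y‖ ≤ 1 / m - δ := by
  set S := sSup (dualNorm N '' {u : Fin m → ℝ | ∀ i, u i ∈ Icc (-1 : ℝ) 1}) with hS
  -- Were this denominator zero, `maxStep` would collapse under division by zero; the all-ones
  -- vector witnesses that both factors are positive.
  have hpos : 0 < normConst N * S := by
    by_contra! hc
    have hm : 0 < m := by
      by_contra! hm
      obtain rfl : m = 0 := by omega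
      simpa using hy.1.2
    have e0 : 0 < ‖(fun _ => 1 : Fin m → ℝ)‖ := by
      rw [norm_pos_iff]
      intro h
      exact one_ne_zero (congrFun h ⟨0, hm⟩)
    have h1 := norm_le_normConst_mul hN (fun _ => 1 : Fin m → ℝ)
    have h2 := dotProduct_le_dualNorm_mul hN (fun _ => 1 : Fin m → ℝ) (fun _ => 1)
    have h3 : dualNorm N (fun _ => 1 : Fin m → ℝ) ≤ S :=
      dualNorm_le_sSup_cube hN fun i => by simp
    have h4 : (fun _ => 1 : Fin m → ℝ) ⬝ᵥ (fun _ => 1) = m := by simp [dotProduct]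
    have hm' : (0 : ℝ) < m := by exact_mod_cast hm
    have n1 := apply_nonneg N (fun _ => 1 : Fin m → ℝ)
    have a1 : 0 < normConst N := pos_of_mul_pos_left (e0.trans_le h1) n1
    have a2 : 0 < dualNorm N (fun _ => 1 : Fin m → ℝ) :=
      pos_of_mul_pos_left (hm'.trans_le (h4 ▸ h2)) n1
    have := mul_pos a1 (a2.trans_le h3)
    linarith
  have h1 := hy.strong_le hs hy'.1
  have h2 := hy'.strong_le hs hy.1
  rw [← map_neg_eq_map N (y - y'), neg_sub] at h2
  -- Adding strong optimality of `y` tested at `y'` to that of `y'` tested at `y` cancels the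
  -- regularizer.
  have h3 : α * N (y' - y) ^ 2 ≤ (z' - z) ⬝ᵥ (y' - y) := by
    simp only [dotProduct_sub, sub_dotProduct]
    linarith
  have h4 : (z' - z) ⬝ᵥ (y' - y) ≤ η * (S * N (y' - y)) := by
    rw [hz, smul_dotProduct, smul_eq_mul]
    refine mul_le_mul_of_nonneg_left ((dotProduct_le_dualNorm_mul hN _ _).trans ?_) hη.le
    exact mul_le_mul_of_nonneg_right (dualNorm_le_sSup_cube hN hu) (apply_nonneg N _)
  have hc : 0 ≤ normConst N :=
    Real.sSup_nonneg (by
      rintro _ ⟨u, -, rfl⟩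
      exact div_nonneg (norm_nonneg _) (apply_nonneg N _))
  have h5 : α * N (y' - y) ≤ η * S := by
    rcases (apply_nonneg N (y' - y)).eq_or_lt with h | h
    · rw [← h, mul_zero]
      exact mul_nonneg hη.le (pos_of_mul_pos_right hpos hc).le
    · refine le_of_mul_le_mul_right (a := N (y' - y)) ?_ h
      linarith
  have h6 := norm_le_normConst_mul hN (y' - y)
  rw [maxStep, ← hS, div_mul_eq_mul_div, le_div_iff₀ hpos] at hη'
  have h7 := mul_le_mul_of_nonneg_left h5 hc
  refine le_of_mul_le_mul_left (a := α) ?_ hα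
  nlinarith

end Norms

/-! ### Responses along the ray of the constant play -/

section BestResponses

variable {n m : ℕ} {A : Matrix (Fin n) (Fin m) ℝ} {x : Fin n → ℝ} {i j : Fin m}

theorem mem_bestResp : i ∈ bestResp A x ↔ ∀ j, Matrix.vecMul x A i ≤ Matrix.vecMul x A j := by
  simp [bestResp]

theorem vecMul_eq_of_mem_bestResp (hi : i ∈ bestResp A x) (hj : j ∈ bestResp A x) :
    Matrix.vecMul x A i = Matrix.vecMul x A j :=
  le_antisymm (mem_bestResp.1 hi j) (mem_bestResp.1 hj i)

theorem gap_eq_sub (hi : i ∈ bestResp A x) (j : Fin m) :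
    gap A x j = Matrix.vecMul x A j - Matrix.vecMul x A i := by
  have : Nonempty (Fin m) := ⟨i⟩
  rw [gap, le_antisymm (ciInf_le (Finite.bddBelow_range _) i) (le_ciInf (mem_bestResp.1 hi))]

theorem gap_pos (hi : i ∈ bestResp A x) (hj : j ∉ bestResp A x) : 0 < gap A x j := by
  rw [gap_eq_sub hi, sub_pos]
  by_contra! h
  exact hj (mem_bestResp.2 fun l => h.trans (mem_bestResp.1 hi l))

theorem exists_gapMin_eq (hj : j ∉ bestResp A x) :
    ∃ l, l ∉ bestResp A x ∧ gap A x l = gapMin A x := by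
  have : Nonempty {i : Fin m // i ∉ bestResp A x} := ⟨⟨j, hj⟩⟩
  obtain ⟨l, hl⟩ := exists_eq_ciInf_of_finite
    (f := fun i : {i : Fin m // i ∉ bestResp A x} => gap A x i)
  exact ⟨l, l.2, hl⟩

theorem gap_le_gapMax (hj : j ∉ bestResp A x) : gap A x j ≤ gapMax A x :=
  le_ciSup (f := fun i : {i : Fin m // i ∉ bestResp A x} => gap A x i)
    (Finite.bddAbove_range _) ⟨j, hj⟩

namespace IsChoice

variable {θ : ℝ → ℝ} {c : ℝ} {y : Fin m → ℝ}

theorem le_of_mem_bestResp (hθ : IsKernel θ) (hc : 0 ≤ c)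
    (hy : IsChoice θ (c • Matrix.vecMul x (-A)) y) (hi : i ∈ bestResp A x) (j : Fin m) :
    y j ≤ y i := by
  refine hy.le_of_le hθ ?_
  simp only [Matrix.vecMul_neg, Pi.smul_apply, Pi.neg_apply, smul_eq_mul]
  exact mul_le_mul_of_nonneg_left (neg_le_neg (mem_bestResp.1 hi j)) hc

theorem eq_of_mem_bestResp (hθ : IsKernel θ) (hc : 0 ≤ c)
    (hy : IsChoice θ (c • Matrix.vecMul x (-A)) y) (hi : i ∈ bestResp A x)
    (hj : j ∈ bestResp A x) : y i = y j :=
  le_antisymm (hy.le_of_mem_bestResp hθ hc hj i) (hy.le_of_mem_bestResp hθ hc hi j)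

/-- Best responses carry the largest coordinates, and the average coordinate is `1 / m`. -/
theorem one_div_le_of_mem_bestResp (hθ : IsKernel θ) (hc : 0 ≤ c)
    (hy : IsChoice θ (c • Matrix.vecMul x (-A)) y) (hi : i ∈ bestResp A x) :
    1 / (m : ℝ) ≤ y i := by
  have hm : (0 : ℝ) < m := by exact_mod_cast i.pos
  rw [div_le_iff₀ hm, ← hy.1.2]
  refine (Finset.sum_le_sum fun l _ => hy.le_of_mem_bestResp hθ hc hi l).trans ?_
  simp [mul_comm]

/-- Two best responses have equal mass, and together at most `1`. -/
theorem le_half_of_mem_bestResp (hθ : IsKernel θ) (hc : 0 ≤ c)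
    (hy : IsChoice θ (c • Matrix.vecMul x (-A)) y) (hi : i ∈ bestResp A x)
    (hj : j ∈ bestResp A x) (hij : i ≠ j) : y i ≤ 1 / 2 := by
  have h := hy.eq_of_mem_bestResp hθ hc hi hj
  have hsum : y i + y j ≤ 1 := by
    rw [← hy.1.2, ← Finset.sum_pair hij]
    exact Finset.sum_le_sum_of_subset_of_nonneg (Finset.subset_univ _) fun l _ _ => hy.1.1 l
  linarith

/-- The movement of the choice caused by one play `w`, against the best responses `i, j`. -/
theorem sq_sub_le_dotProduct (hθ : IsKernel θ) (hc : 0 ≤ c) {δ η : ℝ} (hδ0 : 0 < δ)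
    (hδ1 : δ < 1 / m) {w : Fin n → ℝ} {z' y' : Fin m → ℝ}
    (hy : IsChoice θ (c • Matrix.vecMul x (-A)) y) (hy' : IsChoice θ z' y')
    (hz : z' - c • Matrix.vecMul x (-A) = η • Matrix.vecMul w (-A)) (hyy : ‖y' - y‖ ≤ 1 / m - δ)
    (hi : i ∈ bestResp A x) (hj : j ∈ bestResp A x) (hij : i ≠ j) :
    η ^ 2 * (Matrix.vecMul w A i - Matrix.vecMul w A j) ^ 2 ≤
      2 * sSup (deriv (deriv θ) '' Icc δ (1 - δ)) *
        ((η • Matrix.vecMul w (-A)) ⬝ᵥ (y' - y)) := by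
  have hm : 2 ≤ m := by
    have := i.2
    have := j.2
    by_contra! h
    exact hij (Fin.ext (by omega))
  have hm2 : 1 / (m : ℝ) ≤ 1 / 2 :=
    one_div_le_one_div_of_le two_pos (by exact_mod_cast hm)
  -- The coordinate starts in `[1/m, 1/2]` and moves by at most `1/m - δ`: it stays above `δ`, and
  -- below `1/2 + 1/m - δ ≤ 1 - δ` since `m ≥ 2`.
  have mem : ∀ l ∈ bestResp A x, y l ≤ 1 / 2 → y l ∈ Icc δ (1 - δ) ∧ y' l ∈ Icc δ (1 - δ) := by
    intro l hl h2
    have h1 := hy.one_div_le_of_mem_bestResp hθ hc hl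
    have h3 := abs_le.1 ((norm_le_pi_norm (y' - y) l).trans hyy)
    simp only [Pi.sub_apply] at h3
    exact ⟨⟨by linarith, by linarith⟩, by linarith, by linarith⟩
  obtain ⟨i1, i2⟩ := mem i hi (hy.le_half_of_mem_bestResp hθ hc hi hj hij)
  obtain ⟨j1, j2⟩ := mem j hj (hy.le_half_of_mem_bestResp hθ hc hj hi hij.symm)
  have hsub : Icc δ (1 - δ) ⊆ Ioo (0 : ℝ) 1 :=
    fun x hx => ⟨by linarith [hx.1], by linarith [hx.2]⟩
  have hmono := hy.sum_deriv_sub_mul_le hθ hy' {i, j} (by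
    intro l hl
    rcases Finset.mem_insert.1 hl with rfl | hl
    · exact ⟨hsub i1, hsub i2⟩
    · rw [Finset.mem_singleton.1 hl]
      exact ⟨hsub j1, hsub j2⟩)
  rw [Finset.sum_pair hij, hz] at hmono
  have e1 := hy.deriv_sub_deriv_eq hθ (hsub i1) (hsub j1)
  have e2 := hy'.deriv_sub_deriv_eq hθ (hsub i2) (hsub j2)
  have e3 := congrFun hz i
  have e4 := congrFun hz j
  have q1 := hθ.sq_deriv_sub_le hδ0 i1 i2
  have q2 := hθ.sq_deriv_sub_le hδ0 j1 j2
  have hM := hθ.sSup_deriv_deriv_pos hδ0 (hδ1.trans_le hm2)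
  have hmono' := mul_le_mul_of_nonneg_left hmono hM.le
  simp only [Matrix.vecMul_neg, Pi.smul_apply, Pi.sub_apply, Pi.neg_apply, smul_eq_mul]
    at e1 e2 e3 e4 hmono'
  rw [Matrix.vecMul_neg]
  set p := deriv θ (y' i) - deriv θ (y i)
  set q := deriv θ (y' j) - deriv θ (y j)
  -- First-order conditions determine `θ'` only up to a common shift, so just the difference `p - q`
  -- is known; `(p - q)² ≤ 2 (p² + q²)` is the source of the factor `2`.
  have hpq : p - q = -(η * (Matrix.vecMul w A i - Matrix.vecMul w A j)) := by
    simp only [p, q]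
    linarith
  have hsq : η ^ 2 * (Matrix.vecMul w A i - Matrix.vecMul w A j) ^ 2 = (p - q) ^ 2 := by
    rw [hpq]; ring
  nlinarith [sq_nonneg (p + q)]


/-- The accuracy of a choice against the constant play bounds the scaled gaps from below. -/
theorem one_sub_le_card_mul (hθ : IsKernel θ) (hc : 0 ≤ c)
    (hy : IsChoice θ (c • Matrix.vecMul x (-A)) y) {γ : ℝ}
    (hacc : ∑ j, |y j - uniformBestResp A x j| ≤ γ) (hi : i ∈ bestResp A x) :
    1 - γ / 2 ≤ (bestResp A x).card * y i ∧
      ∑ j ∈ (bestResp A x)ᶜ, y j ≤ γ / 2 := by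
  classical
  have hk : (0 : ℝ) < (bestResp A x).card := by exact_mod_cast Finset.card_pos.2 ⟨i, hi⟩
  have h1 : ∑ j ∈ bestResp A x, y j = (bestResp A x).card * y i := by
    rw [Finset.sum_congr rfl fun j hj => hy.eq_of_mem_bestResp hθ hc hj hi]
    simp
  have h2 := Finset.sum_add_sum_compl (bestResp A x) y
  rw [hy.1.2, h1] at h2
  have h3 : ∑ j ∈ (bestResp A x)ᶜ, |y j - uniformBestResp A x j| =
      ∑ j ∈ (bestResp A x)ᶜ, y j := by
    refine Finset.sum_congr rfl fun j hj => ?_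
    rw [uniformBestResp, if_neg (Finset.mem_compl.1 hj), sub_zero, abs_of_nonneg (hy.1.1 j)]
  have h4 : ∑ j ∈ bestResp A x, |y j - uniformBestResp A x j| =
      |(bestResp A x).card * y i - 1| := by
    have : ∀ j ∈ bestResp A x, |y j - uniformBestResp A x j| =
        |y i - 1 / (bestResp A x).card| := by
      intro j hj
      rw [uniformBestResp, if_pos hj, hy.eq_of_mem_bestResp hθ hc hj hi]
    rw [Finset.sum_congr rfl this, Finset.sum_const, nsmul_eq_mul, ← abs_of_pos hk,
      ← abs_mul, abs_of_pos hk, mul_sub, mul_one_div_cancel hk.ne']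
  rw [← Finset.sum_add_sum_compl (bestResp A x), h3, h4] at hacc
  -- The mass missing on the best responses equals the mass outside them, so the `ℓ¹` error counts
  -- it twice; hence `γ / 2`.
  have := neg_le_abs ((bestResp A x).card * y i - 1)
  constructor <;> linarith

/-- Against a constant play, an accurate learner has moved far: gap of the least used column. -/
theorem deriv_sub_le_mul_gap (hθ : IsKernel θ) (hc : 0 ≤ c)
    (hy : IsChoice θ (c • Matrix.vecMul x (-A)) y) {γ q : ℝ} (hγ0 : 0 < γ) (hγ2 : γ < 2)
    (hacc : ∑ j, |y j - uniformBestResp A x j| ≤ γ) (hi : i ∈ bestResp A x)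
    (hk2 : 2 ≤ (bestResp A x).card) (hj : j ∉ bestResp A x) (hq : q ∈ Ioo (0 : ℝ) 1)
    (hjq : y j ≤ q) :
    deriv θ ((1 - γ / 2) / (bestResp A x).card) - deriv θ q ≤ c * gap A x j := by
  have hk : (2 : ℝ) ≤ (bestResp A x).card := by exact_mod_cast hk2
  have h1 := (hy.one_sub_le_card_mul hθ hc hacc hi).1
  have hij : i ≠ j := by rintro rfl; exact hj hi
  have h := hy.deriv_sub_deriv_le hθ hij (p := (1 - γ / 2) / (bestResp A x).card) (q := q)
    ⟨div_pos (by linarith) (by linarith), by rw [div_lt_one (by linarith)]; linarith⟩ hq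
    (by rw [div_le_iff₀ (by linarith)]; linarith) hjq
  rw [gap_eq_sub hi]
  simp only [Matrix.vecMul_neg, Pi.smul_apply, Pi.neg_apply, smul_eq_mul] at h
  linarith

end IsChoice

end BestResponses

/-! ### The alternating play and its gain -/

section Exploitation

variable {n m : ℕ}

/-- A direction within the simplex along which `c` grows by a fraction of its least modulus. -/
theorem exists_direction {x c : Fin n → ℝ} {g : ℝ} (hx : x ∈ stdSimplex ℝ (Fin n))
    (hxc : ∑ l, x l * c l = 0) (hc : ∀ l, g ≤ |c l|) :
    ∃ d : Fin n → ℝ, ∑ l, d l = 0 ∧ (∀ l, |d l| ≤ x l) ∧ g / 2 ≤ ∑ l, d l * c l := by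
  classical
  -- The direction shifts mass to the rows with `c > 0`, recentred by their total weight `P`. Since
  -- `c` has `x`-mean zero, its positive part has mean half that of `|c|`, which gives `g / 2`.
  set σ : Fin n → ℝ := fun l => if 0 < c l then 1 else 0 with hσ
  have hσ01 : ∀ l, 0 ≤ σ l ∧ σ l ≤ 1 := fun l => by
    simp only [hσ]; split_ifs <;> norm_num
  set P := ∑ l, x l * σ l with hP
  have hP0 : 0 ≤ P := Finset.sum_nonneg fun l _ => mul_nonneg (hx.1 l) (hσ01 l).1
  have hP1 : P ≤ 1 := by
    rw [← hx.2]
    exact Finset.sum_le_sum fun l _ => mul_le_of_le_one_right (hx.1 l) (hσ01 l).2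
  refine ⟨fun l => x l * (σ l - P), ?_, fun l => ?_, ?_⟩
  · simp only [mul_sub, Finset.sum_sub_distrib, ← Finset.sum_mul, hx.2, ← hP]
    ring
  · rw [abs_mul, abs_of_nonneg (hx.1 l)]
    refine mul_le_of_le_one_right (hx.1 l) (abs_le.2 ?_)
    constructor <;> linarith [(hσ01 l).1, (hσ01 l).2]
  · have e : ∀ l, x l * (σ l - P) * c l = (x l * |c l| + x l * c l) / 2 - P * (x l * c l) := by
      intro l
      simp only [hσ]
      split_ifs with h
      · rw [abs_of_pos h]; ring
      · rw [abs_of_nonpos (not_lt.1 h)]; ring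
    simp only [e, Finset.sum_sub_distrib, ← Finset.sum_div, ← Finset.mul_sum,
      Finset.sum_add_distrib, hxc]
    have : g ≤ ∑ l, x l * |c l| := by
      calc g = ∑ l, x l * g := by rw [← Finset.sum_mul, hx.2, one_mul]
        _ ≤ _ := Finset.sum_le_sum fun l _ => mul_le_mul_of_nonneg_left (hc l) (hx.1 l)
    linarith

theorem vecMul_mem_Icc {A : Matrix (Fin n) (Fin m) ℝ} (hA : ∀ i j, A i j ∈ Icc (-1 : ℝ) 1)
    {x : Fin n → ℝ} (hx : x ∈ stdSimplex ℝ (Fin n)) (j : Fin m) :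
    Matrix.vecMul x A j ∈ Icc (-1 : ℝ) 1 := by
  have h1 : Matrix.vecMul x A j = ∑ i, x i * A i j := rfl
  rw [h1]
  constructor
  · calc (-1 : ℝ) = ∑ i, x i * (-1) := by rw [← Finset.sum_mul, hx.2]; ring
      _ ≤ _ := Finset.sum_le_sum fun i _ => mul_le_mul_of_nonneg_left (hA i j).1 (hx.1 i)
  · calc ∑ i, x i * A i j ≤ ∑ i, x i * 1 :=
        Finset.sum_le_sum fun i _ => mul_le_mul_of_nonneg_left (hA i j).2 (hx.1 i)
      _ = 1 := by rw [← Finset.sum_mul, hx.2]; ring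

variable {θ : ℝ → ℝ} {A : Matrix (Fin n) (Fin m) ℝ} {η : ℝ}

theorem isChoice_response (hm : 0 < m) (hθ : IsKernel θ) (X : ℕ → stdSimplex ℝ (Fin n)) (t : ℕ) :
    IsChoice θ (η • ∑ τ ∈ Finset.range t, Matrix.vecMul (X τ : Fin n → ℝ) (-A))
      (response θ A η X t) :=
  isChoice_choiceMap hm hθ _

theorem dotProduct_mulVec_eq (x : Fin n → ℝ) (y : Fin m → ℝ) :
    x ⬝ᵥ A.mulVec y = Matrix.vecMul x A ⬝ᵥ y := Matrix.dotProduct_mulVec x A y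

/-- Some play that ends at the same cumulative payoff as the constant play exploits the learner at
rate `exploitRate` per unit of step size. -/
theorem exists_exploiting_play (hθ : IsKernel θ) {N : Seminorm ℝ (Fin m → ℝ)}
    (hN : ∀ u, N u = 0 → u = 0) {α δ : ℝ} (hα : 0 < α)
    (hstrong : StronglyConvexWrt N α (sepReg θ)) (hδ0 : 0 < δ) (hδ1 : δ < 1 / (m : ℝ))
    (hA : ∀ i j, A i j ∈ Icc (-1 : ℝ) 1) (hgap : EntryGap A) {xs : stdSimplex ℝ (Fin n)}
    (hxs : IsMaxMin A xs) {i j : Fin m} (hi : i ∈ bestResp A xs) (hj : j ∈ bestResp A xs)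
    (hij : i ≠ j) (hη : 0 < η) (hη' : η ≤ maxStep N α δ) {t : ℕ} (ht : 2 ≤ t) :
    ∃ X : ℕ → stdSimplex ℝ (Fin n),
      response θ A η X t = response θ A η (fun _ => xs) t ∧
        exploitRate n m θ δ * (η * t) / 2 ≤ exploitation θ A η X t := by
  have hm : 0 < m := i.pos
  have hm2 : 2 ≤ m := by
    have := i.2
    have := j.2
    by_contra! h
    exact hij (Fin.ext (by omega))
  have hδ2 : δ < 1 / 2 := hδ1.trans_le
    (one_div_le_one_div_of_le two_pos (by exact_mod_cast hm2))
  set M := sSup (deriv (deriv θ) '' Icc δ (1 - δ)) with hMdef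
  have hM : 0 < M := hθ.sSup_deriv_deriv_pos hδ0 hδ2
  have hxc : ∑ l, (xs : Fin n → ℝ) l * (A l i - A l j) = 0 := by
    simp only [mul_sub, Finset.sum_sub_distrib]
    exact sub_eq_zero.2 (vecMul_eq_of_mem_bestResp hi hj)
  have hn0 : 0 < n := by
    by_contra! h
    obtain rfl : n = 0 := by omega
    simpa using xs.2.2
  have hmR : (0 : ℝ) < m := by exact_mod_cast hm
  -- With one row, two best responses would have equal entries, against `EntryGap`.
  have hn2 : 2 ≤ n := by
    by_contra! h
    obtain rfl : n = 1 := by omega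
    have h1 : (xs : Fin 1 → ℝ) 0 = 1 := by simp
    have h2 := hgap 0 i j hij
    simp only [Finset.univ_unique, Fin.default_eq_zero, Finset.sum_singleton, h1, one_mul] at hxc
    rw [hxc, abs_zero] at h2
    have : 0 < 2 / (((1 : ℕ) : ℝ) ^ 2 * (m : ℝ) ^ 3) := by positivity
    linarith
  have hnR : (2 : ℝ) ≤ n := by exact_mod_cast hn2
  obtain ⟨d, hd0, hdx, hdc⟩ := exists_direction (x := (xs : Fin n → ℝ)) xs.2 hxc fun l => hgap l i j hij
  have hp : (xs : Fin n → ℝ) + d ∈ stdSimplex ℝ (Fin n) :=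
    ⟨fun l => by have := abs_le.1 (hdx l); simp only [Pi.add_apply]; linarith,
      by simp [Finset.sum_add_distrib, hd0]⟩
  have hq : (xs : Fin n → ℝ) - d ∈ stdSimplex ℝ (Fin n) :=
    ⟨fun l => by have := abs_le.1 (hdx l); simp only [Pi.sub_apply]; linarith,
      by simp [Finset.sum_sub_distrib, hd0]⟩
  set w : Fin n → ℝ := (xs : Fin n → ℝ) + d with hw
  set s := t / 2 with hs
  -- An odd horizon leaves one last round, filled with `xs` itself; it loses nothing because `xs` is
  -- max-min.
  set X : ℕ → stdSimplex ℝ (Fin n) := fun τ =>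
    if τ < 2 * s then (if Even τ then ⟨w, hp⟩ else ⟨_, hq⟩) else xs with hX
  have X0 : ∀ r < s, (X (2 * r) : Fin n → ℝ) = w := fun r hr => by
    simp only [hX]
    rw [if_pos (by omega), if_pos (by simp)]
    rfl
  have X1 : ∀ r < s, (X (2 * r + 1) : Fin n → ℝ) = (xs : Fin n → ℝ) - d := fun r hr => by
    simp only [hX]
    rw [if_pos (by omega), if_neg (by simp)]
    rfl
  have X2 : (X (2 * s) : Fin n → ℝ) = xs := by simp [hX]
  set v := Matrix.vecMul (xs : Fin n → ℝ) (-A) with hv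
  have cum : ∀ r ≤ s, ∑ τ ∈ Finset.range (2 * r), Matrix.vecMul (X τ : Fin n → ℝ) (-A) =
      ((2 * r : ℕ) : ℝ) • v := by
    intro r
    induction r with
    | zero => simp
    | succ r ih =>
      intro hr
      rw [mul_add, mul_one, Finset.sum_range_succ, Finset.sum_range_succ, ih (by omega),
        X0 r (by omega), X1 r (by omega), hw, Matrix.add_vecMul, Matrix.sub_vecMul, ← hv]
      push_cast
      module
  have cumt : ∑ τ ∈ Finset.range t, Matrix.vecMul (X τ : Fin n → ℝ) (-A) = (t : ℝ) • v := by
    rcases Nat.even_or_odd' t with ⟨r, hr | hr⟩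
    · have : r = s := by omega
      rw [hr, this]
      exact cum s le_rfl
    · have : r = s := by omega
      rw [hr, this, Finset.sum_range_succ, cum s le_rfl, X2]
      push_cast
      module
  have nonneg : ∀ y ∈ stdSimplex ℝ (Fin m), 0 ≤ Matrix.vecMul (xs : Fin n → ℝ) A ⬝ᵥ y -
      gameValue A := fun y hy => by
    have := hxs.2 y hy
    rw [dotProduct_mulVec_eq] at this
    linarith
  set G := η * (1 / ((n : ℝ) ^ 2 * (m : ℝ) ^ 3)) ^ 2 / (2 * M) with hG
  have pair : ∀ r < s, G ≤
      ((X (2 * r) : Fin n → ℝ) ⬝ᵥ A.mulVec (response θ A η X (2 * r)) - gameValue A) +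
      ((X (2 * r + 1) : Fin n → ℝ) ⬝ᵥ A.mulVec (response θ A η X (2 * r + 1)) -
        gameValue A) := by
    intro r hr
    have hy := isChoice_response (η := η) (A := A) hm hθ X (2 * r)
    have hy' := isChoice_response (η := η) (A := A) hm hθ X (2 * r + 1)
    rw [Finset.sum_range_succ, cum r hr.le, X0 r hr, smul_add] at hy'
    rw [cum r hr.le, smul_smul] at hy
    rw [smul_smul] at hy'
    rw [X0 r hr, X1 r hr]
    set y := response θ A η X (2 * r)
    set y' := response θ A η X (2 * r + 1)
    have hz := add_sub_cancel_left ((η * ((2 * r : ℕ) : ℝ)) • v) (η • Matrix.vecMul w (-A))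
    have hc : 0 ≤ η * ((2 * r : ℕ) : ℝ) := by positivity
    have hyy := hy.norm_sub_le_of_le_maxStep hN hα hstrong hη hη' hy'
      (u := Matrix.vecMul w (-A)) (vecMul_mem_Icc (fun i j => by
        have := hA i j
        simp only [Matrix.neg_apply]
        exact ⟨by linarith [this.2], by linarith [this.1]⟩) hp) hz
    have h1 := hy.sq_sub_le_dotProduct hθ hc hδ0 hδ1 hy' hz hyy hi hj hij
    have h2 : 1 / ((n : ℝ) ^ 2 * (m : ℝ) ^ 3) ≤ Matrix.vecMul w A i - Matrix.vecMul w A j := by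
      have : Matrix.vecMul w A i - Matrix.vecMul w A j = ∑ l, d l * (A l i - A l j) := by
        have e := vecMul_eq_of_mem_bestResp hi hj
        rw [hw, Matrix.add_vecMul, Pi.add_apply, Pi.add_apply, e]
        simp only [Matrix.vecMul, dotProduct, mul_sub, Finset.sum_sub_distrib]
        ring
      rw [this]
      refine le_trans (le_of_eq ?_) hdc
      ring
    have h3 : (1 / ((n : ℝ) ^ 2 * (m : ℝ) ^ 3)) ^ 2 ≤
        (Matrix.vecMul w A i - Matrix.vecMul w A j) ^ 2 :=
      pow_le_pow_left₀ (by positivity) h2 2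
    have h4 := nonneg y' hy'.1
    rw [smul_dotProduct, smul_eq_mul] at h1
    have h5 : G ≤ Matrix.vecMul w (-A) ⬝ᵥ (y' - y) := by
      rw [hG, div_le_iff₀ (by positivity)]
      refine le_of_mul_le_mul_left (a := η) ?_ hη
      nlinarith [mul_le_mul_of_nonneg_left h3 (sq_nonneg η)]
    refine h5.trans ?_
    -- With the second play written as `2 xs - w`, the reward of the pair splits into two rounds of
    -- `xs` against `y'` plus the monotonicity term bounded in `h5`.
    have e2 : (xs : Fin n → ℝ) - d = (2 : ℝ) • (xs : Fin n → ℝ) - w := by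
      rw [hw]; module
    rw [dotProduct_mulVec_eq, dotProduct_mulVec_eq, e2, Matrix.sub_vecMul, Matrix.smul_vecMul,
      Matrix.vecMul_neg]
    simp only [neg_dotProduct, dotProduct_sub, sub_dotProduct, smul_dotProduct, smul_eq_mul]
    linarith
  have total : ∀ r ≤ s, r * G ≤ ∑ τ ∈ Finset.range (2 * r),
      ((X τ : Fin n → ℝ) ⬝ᵥ A.mulVec (response θ A η X τ) - gameValue A) := by
    intro r
    induction r with
    | zero => simp
    | succ r ih =>
      intro hr
      rw [mul_add, mul_one, Finset.sum_range_succ, Finset.sum_range_succ]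
      have := ih (by omega)
      have := pair r (by omega)
      push_cast
      linarith
  refine ⟨X, ?_, ?_⟩
  · rw [response, cumt, response, Finset.sum_const, Finset.card_range, ← hv, Nat.cast_smul_eq_nsmul]
  · have e : exploitation θ A η X t = ∑ τ ∈ Finset.range t,
        ((X τ : Fin n → ℝ) ⬝ᵥ A.mulVec (response θ A η X τ) - gameValue A) := by
      simp [exploitation, Finset.sum_sub_distrib]
    have hle : s * G ≤ exploitation θ A η X t := by
      rw [e]
      rcases Nat.even_or_odd' t with ⟨r, hr | hr⟩
      · have : r = s := by omega
        rw [hr, this]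
        exact total s le_rfl
      · have : r = s := by omega
        rw [hr, this, Finset.sum_range_succ, X2]
        have h1 := total s le_rfl
        have h2 := nonneg _ (isChoice_response (η := η) (A := A) hm hθ X (2 * s)).1
        rw [dotProduct_mulVec_eq (xs : Fin n → ℝ)]
        linarith
    refine le_trans ?_ hle
    -- The worst case of `s = t / 2` rounded down is `t = 3`, given `t ≥ 2`. Since `n² ≥ 4`, the
    -- loss is absorbed by passing from the `n⁴` in `G` to the `n⁶` in `exploitRate`.
    have hst : (t : ℝ) ≤ 3 * s := by
      have : t ≤ 3 * s := by omega
      exact_mod_cast this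
    have hn4 : (4 : ℝ) ≤ (n : ℝ) ^ 2 := by nlinarith
    have eG : s * G = exploitRate n m θ δ * (η * (s * (n : ℝ) ^ 2)) / 2 := by
      rw [hG, exploitRate, ← hMdef]
      field_simp
    rw [eG]
    have hrate : 0 ≤ exploitRate n m θ δ := by
      rw [exploitRate, ← hMdef]; positivity
    have : (t : ℝ) ≤ s * (n : ℝ) ^ 2 := by nlinarith [Nat.cast_nonneg (α := ℝ) s]
    gcongr

end Exploitation

/-! ### From accuracy to lower bounds on the price of precision -/

section PriceOfPrecision

variable {n m : ℕ} {θ : ℝ → ℝ} {A : Matrix (Fin n) (Fin m) ℝ}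

theorem response_const (xs : stdSimplex ℝ (Fin n)) (η : ℝ) (t : ℕ) :
    response θ A η (fun _ => xs) t =
      choiceMap θ ((η * t) • Matrix.vecMul (xs : Fin n → ℝ) (-A)) := by
  rw [response, Finset.sum_const, Finset.card_range, mul_smul, Nat.cast_smul_eq_nsmul]

theorem exploitRate_pos (hθ : IsKernel θ) (hn : 0 < n) (hm : 0 < m) {δ : ℝ} (hδ0 : 0 < δ)
    (hδ2 : δ < 1 / 2) : 0 < exploitRate n m θ δ := by
  have hM := hθ.sSup_deriv_deriv_pos hδ0 hδ2
  have : (0 : ℝ) < n := by exact_mod_cast hn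
  have : (0 : ℝ) < m := by exact_mod_cast hm
  rw [exploitRate]
  positivity

/-- A lower bound on the exploitation for every admissible step size and horizon bounds the price
of precision. -/
theorem le_priceOfPrecision {xs : stdSimplex ℝ (Fin n)} {ηmax γ B : ℝ}
    (h : ∀ (η : ℝ) (t : ℕ), 0 < η → η ≤ ηmax → 2 ≤ t →
      accuracy θ A xs η (fun _ => xs) t ≤ γ →
      ∃ X : ℕ → stdSimplex ℝ (Fin n), accuracy θ A xs η X t ≤ γ ∧ B ≤ exploitation θ A η X t) :
    (B : EReal) ≤ priceOfPrecision θ A xs ηmax γ := by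
  refine le_iInf fun η => le_iInf fun t => le_iInf fun ⟨h1, h2, h3, h4⟩ => ?_
  obtain ⟨X, hX, hB⟩ := h η t h1 h2 h3 h4
  exact (EReal.coe_le_coe_iff.2 hB).trans
    (le_iSup₂ (f := fun (x : ℕ → stdSimplex ℝ (Fin n)) (_ : accuracy θ A xs η x t ≤ γ) =>
      ((exploitation θ A η x t : ℝ) : EReal)) X hX)

variable {xs : stdSimplex ℝ (Fin n)} {N : Seminorm ℝ (Fin m → ℝ)} {α δ : ℝ}

/-- The price of precision is at least the exploitation rate times the total step `η t` that the
accuracy against the constant play forces. -/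
theorem exploitRate_mul_le_priceOfPrecision (hθ : IsKernel θ)
    (hN : ∀ u, N u = 0 → u = 0) (hα : 0 < α) (hstrong : StronglyConvexWrt N α (sepReg θ))
    (hδ0 : 0 < δ) (hδ1 : δ < 1 / (m : ℝ)) (hA : GoodGame A) (hxs : IsMaxMin A xs)
    (hni : NonIdentified A xs) {γ L : ℝ}
    (hL : ∀ c : ℝ, 0 ≤ c → ∀ y, IsChoice θ (c • Matrix.vecMul (xs : Fin n → ℝ) (-A)) y →
      ∑ j, |y j - uniformBestResp A xs j| ≤ γ → exploitRate n m θ δ * L ≤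
        exploitRate n m θ δ * c) :
    ((exploitRate n m θ δ / 2 * L : ℝ) : EReal) ≤ priceOfPrecision θ A xs (maxStep N α δ) γ := by
  obtain ⟨i, hi, j, hj, l, -, hlij⟩ := hni
  have hij : i ≠ j := by rintro rfl; exact hlij rfl
  refine le_priceOfPrecision fun η t hη hη' ht hacc => ?_
  obtain ⟨X, hX, hXe⟩ := exists_exploiting_play hθ hN hα hstrong hδ0 hδ1 hA.1 hA.2.1 hxs hi hj
    hij hη hη' ht
  refine ⟨X, by rwa [accuracy, hX], le_trans ?_ hXe⟩
  rw [accuracy, response_const] at hacc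
  have := hL (η * t) (by positivity) _ (isChoice_choiceMap i.pos hθ _) hacc
  linarith

/-- The lower bounds on the price of precision on the event `GoodGame`. -/
theorem priceOfPrecision_bounds (hθ : IsKernel θ)
    (hN : ∀ u, N u = 0 → u = 0) (hα : 0 < α) (hstrong : StronglyConvexWrt N α (sepReg θ))
    (hδ0 : 0 < δ) (hδ1 : δ < 1 / (m : ℝ)) (hA : GoodGame A) (hxs : IsMaxMin A xs)
    (hni : NonIdentified A xs) {k : ℕ} (hk : k = (bestResp A xs).card) (hkm : k < m) :
    0 < gapMin A xs ∧ 0 < gameConst θ A xs δ ∧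
      (∀ γ : ℝ, 0 < γ → γ < 2 →
        ((gameConst θ A xs δ / (2 * gapMin A xs) *
          (deriv θ ((1 - γ / 2) / k) - deriv θ (γ / (2 * ((m : ℝ) - k)))) : ℝ) : EReal)
          ≤ priceOfPrecision θ A xs (maxStep N α δ) γ) ∧
      (∀ γ : ℝ, 0 < γ → γ < 2 →
        ((exploitRate n m θ δ / (2 * gapMin A xs) *
          (deriv θ ((1 - γ / 2) / k) - deriv θ (γ / 2)) : ℝ) : EReal)
          ≤ priceOfPrecision θ A xs (maxStep N α δ) γ) := by
  classical
  have hni' := hni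
  obtain ⟨i, hi, i', hi', l, -, hlij⟩ := hni'
  have hii : i ≠ i' := by rintro rfl; exact hlij rfl
  have hk2 : 2 ≤ (bestResp A xs).card := by
    rw [← Finset.card_pair hii]
    exact Finset.card_le_card (by
      intro a ha
      rcases Finset.mem_insert.1 ha with rfl | ha
      · exact hi
      · rwa [Finset.mem_singleton.1 ha])
  have hcompl : ((bestResp A xs)ᶜ.card : ℝ) = (m : ℝ) - k := by
    rw [Finset.card_compl, Fintype.card_fin, ← hk, Nat.cast_sub hkm.le]
  have hmk : (1 : ℝ) ≤ (m : ℝ) - k := by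
    have : (k : ℝ) + 1 ≤ m := by exact_mod_cast hkm
    linarith
  have hne : (bestResp A xs)ᶜ.Nonempty := by
    rw [← Finset.card_pos]
    have : (0 : ℝ) < (bestResp A xs)ᶜ.card := by rw [hcompl]; linarith
    exact_mod_cast this
  obtain ⟨j₀, hj₀⟩ := hne
  have hj₀ := Finset.mem_compl.1 hj₀
  obtain ⟨jm, hjm, hjmin⟩ := exists_gapMin_eq hj₀
  have hmin : 0 < gapMin A xs := hjmin ▸ gap_pos hi hjm
  have hmax : 0 < gapMax A xs := hmin.trans_le (hjmin ▸ gap_le_gapMax hjm)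
  have hm2 : 2 ≤ m := by omega
  have hδ2 : δ < 1 / 2 := hδ1.trans_le
    (one_div_le_one_div_of_le two_pos (by exact_mod_cast hm2))
  have hrate : 0 < exploitRate n m θ δ := exploitRate_pos hθ l.pos i.pos hδ0 hδ2
  refine ⟨hmin, mul_pos hrate (div_pos hmin hmax), fun γ h0 h2 => ?_, fun γ h0 h2 => ?_⟩
  · have hL := exploitRate_mul_le_priceOfPrecision (γ := γ)
      (L := (deriv θ ((1 - γ / 2) / k) - deriv θ (γ / (2 * ((m : ℝ) - k)))) / gapMax A xs)
      hθ hN hα hstrong hδ0 hδ1 hA hxs hni (fun c hc y hy hacc => by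
        refine mul_le_mul_of_nonneg_left ?_ hrate.le
        rw [div_le_iff₀ hmax]
        have hsum := (hy.one_sub_le_card_mul hθ hc hacc hi).2
        -- Pigeonhole: mass at most `γ / 2` is spread over `m - k` columns. Which column is light is
        -- unknown, so its gap is replaced by `gapMax`.
        obtain ⟨j, hj, hjq⟩ := Finset.exists_le_of_sum_le (s := (bestResp A xs)ᶜ) ⟨j₀, by simpa⟩
          (f := y) (g := fun _ => γ / (2 * ((m : ℝ) - k))) (by
            refine hsum.trans (le_of_eq ?_)
            rw [Finset.sum_const, nsmul_eq_mul, hcompl]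
            field_simp)
        have hj := Finset.mem_compl.1 hj
        rw [hk] at hjq ⊢
        refine (hy.deriv_sub_le_mul_gap hθ hc h0 h2 hacc hi hk2 hj ⟨?_, ?_⟩ hjq).trans
          (mul_le_mul_of_nonneg_left (gap_le_gapMax hj) hc)
        · rw [← hk]; exact div_pos h0 (by linarith)
        · rw [← hk, div_lt_one (by linarith)]; linarith)
    convert hL using 2
    rw [gameConst]
    field_simp
  · have hL := exploitRate_mul_le_priceOfPrecision (γ := γ)
      (L := (deriv θ ((1 - γ / 2) / k) - deriv θ (γ / 2)) / gapMin A xs)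
      hθ hN hα hstrong hδ0 hδ1 hA hxs hni (fun c hc y hy hacc => by
        refine mul_le_mul_of_nonneg_left ?_ hrate.le
        rw [div_le_iff₀ hmin, ← hjmin]
        have hsum := (hy.one_sub_le_card_mul hθ hc hacc hi).2
        -- Here the column of least gap is prescribed: `gapMax` no longer enters, but its mass is
        -- bounded only by the whole mass outside the best responses.
        have hjq : y jm ≤ γ / 2 := le_trans
          (Finset.single_le_sum (fun j _ => hy.1.1 j) (Finset.mem_compl.2 hjm)) hsum
        rw [hk]
        exact hy.deriv_sub_le_mul_gap hθ hc h0 h2 hacc hi hk2 hjm ⟨by linarith, by linarith⟩ hjq)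
    convert hL using 2
    field_simp

/-- For small `γ` the level `(1 - γ/2)/k` may be replaced by `1/k` at the cost of a factor. -/
theorem eventually_half_mul_le (hθ : IsKernel θ) {k : ℕ} (hk : 2 ≤ k) {r : ℝ} (hr : 1 ≤ r) :
    ∀ᶠ γ in 𝓝[>] (0 : ℝ), (deriv θ (1 / (k : ℝ)) - deriv θ (γ / (2 * r))) / 2 ≤
      deriv θ ((1 - γ / 2) / k) - deriv θ (γ / (2 * r)) := by
  have hkR : (2 : ℝ) ≤ k := by exact_mod_cast hk
  have hk0 : 0 < 1 / (k : ℝ) := by positivity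
  have hk1 : 1 / (k : ℝ) ≤ 1 / 2 := one_div_le_one_div_of_le two_pos hkR
  have hmem : 1 / (k : ℝ) ∈ Ioo (0 : ℝ) 1 := ⟨hk0, by linarith⟩
  have hmem' : 1 / (k : ℝ) / 2 ∈ Ioo (0 : ℝ) 1 := ⟨by linarith, by linarith⟩
  have hlt := hθ.strictMonoOn_deriv hmem' hmem (by linarith)
  have hlim : Tendsto (fun γ : ℝ => deriv θ ((1 - γ / 2) / k)) (𝓝[>] 0)
      (𝓝 (deriv θ (1 / (k : ℝ)))) := by
    refine (hθ.continuousAt_deriv hmem).tendsto.comp ?_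
    have : Tendsto (fun γ : ℝ => (1 - γ / 2) / (k : ℝ)) (𝓝 0) (𝓝 ((1 - 0 / 2) / (k : ℝ))) :=
      Continuous.tendsto (by fun_prop) 0
    rw [zero_div, sub_zero] at this
    exact this.mono_left nhdsWithin_le_nhds
  -- With `a = θ'(1/k)`, `b = θ'(1/(2k))` and `v` the subtracted term, small `γ` gives a first term
  -- above `(a + b) / 2` and `v ≤ b`, and then `(a + b) / 2 - v ≥ (a - v) / 2`.
  have hev := hlim.eventually (lt_mem_nhds
    (show (deriv θ (1 / (k : ℝ)) + deriv θ (1 / (k : ℝ) / 2)) / 2 < deriv θ (1 / (k : ℝ)) by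
      linarith))
  filter_upwards [hev, Ioo_mem_nhdsGT hk0] with γ h1 h2
  have h3 : γ / (2 * r) ≤ 1 / (k : ℝ) / 2 := by
    rw [div_le_iff₀ (by linarith)]
    nlinarith [h2.1, h2.2]
  have h4 := hθ.strictMonoOn_deriv.monotoneOn (a := γ / (2 * r))
    ⟨div_pos h2.1 (by linarith), by linarith⟩ hmem' h3
  linarith

end PriceOfPrecision

/-! ### Max-min strategies and pure saddle points -/

section Existence

variable {n m : ℕ} {A : Matrix (Fin n) (Fin m) ℝ}

/-- A max-min strategy exists, and maximizes the least entry of the payoff vector. -/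
theorem exists_isMaxMin (hn : 0 < n) (hm : 0 < m) (A : Matrix (Fin n) (Fin m) ℝ) :
    ∃ x, IsMaxMin A x ∧ ∀ w ∈ stdSimplex ℝ (Fin n),
      ⨅ j, Matrix.vecMul w A j ≤ ⨅ j, Matrix.vecMul x A j := by
  have : Nonempty (Fin m) := ⟨⟨0, hm⟩⟩
  have hne : (stdSimplex ℝ (Fin n)).Nonempty := ⟨_, single_mem_stdSimplex ℝ (⟨0, hn⟩ : Fin n)⟩
  have hcont : Continuous fun w : Fin n → ℝ => ⨅ j, Matrix.vecMul w A j := by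
    simp only [← Finset.inf'_univ_eq_ciInf]
    refine Continuous.finset_inf'_apply Finset.univ_nonempty fun j _ => ?_
    unfold Matrix.vecMul dotProduct
    fun_prop
  obtain ⟨x, hx, hmax⟩ := (isCompact_stdSimplex ℝ (Fin n)).exists_isMaxOn hne hcont.continuousOn
  have hle : ∀ w : Fin n → ℝ, ∀ y ∈ stdSimplex ℝ (Fin m),
      ⨅ j, Matrix.vecMul w A j ≤ w ⬝ᵥ A.mulVec y := by
    intro w y hy
    rw [dotProduct_mulVec_eq]
    calc ⨅ j, Matrix.vecMul w A j = ∑ j, (⨅ j, Matrix.vecMul w A j) * y j := by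
          rw [← Finset.mul_sum, hy.2, mul_one]
      _ ≤ _ := Finset.sum_le_sum fun j _ =>
          mul_le_mul_of_nonneg_right (ciInf_le (Finite.bddBelow_range _) j) (hy.1 j)
  have : Nonempty (stdSimplex ℝ (Fin n)) := hne.to_subtype
  refine ⟨x, ⟨hx, fun y hy => le_trans (ciSup_le fun w => ?_) (hle x y hy)⟩, fun w hw => hmax hw⟩
  refine le_trans (le_ciInf fun j => ?_) (hmax w.2)
  refine (ciInf_le ⟨⨅ j, Matrix.vecMul (w : Fin n → ℝ) A j, ?_⟩
    ⟨_, single_mem_stdSimplex ℝ j⟩).trans (le_of_eq ?_)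
  · rintro _ ⟨y, rfl⟩
    exact hle w y y.2
  · rw [dotProduct_mulVec_eq]
    exact dotProduct_single_one _ _

/-- If a max-min strategy has a unique best response and the entries of each column are distinct,
then the game has a saddle point in pure strategies. -/
theorem exists_saddle_of_unique_bestResp {x : Fin n → ℝ} (hx : x ∈ stdSimplex ℝ (Fin n))
    (hmax : ∀ w ∈ stdSimplex ℝ (Fin n),
      ⨅ j, Matrix.vecMul w A j ≤ ⨅ j, Matrix.vecMul x A j)
    (hcol : ∀ j i i', i ≠ i' → A i j ≠ A i' j) {j : Fin m}
    (huniq : ∀ j', j' ≠ j → Matrix.vecMul x A j < Matrix.vecMul x A j') :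
    ∃ i, (∀ i', A i' j ≤ A i j) ∧ ∀ j', A i j ≤ A i j' := by
  have : Nonempty (Fin m) := ⟨j⟩
  have hxj : ⨅ j, Matrix.vecMul x A j = Matrix.vecMul x A j := by
    refine le_antisymm (ciInf_le (Finite.bddBelow_range _) j) (le_ciInf fun j' => ?_)
    rcases eq_or_ne j' j with rfl | h
    · exact le_rfl
    · exact (huniq j' h).le
  have hle : ∀ i, A i j ≤ Matrix.vecMul x A j := by
    intro i
    have hcomb : ∀ (s : ℝ) j', Matrix.vecMul ((1 - s) • x + s • Pi.single i 1) A j' =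
        (1 - s) * Matrix.vecMul x A j' + s * A i j' := by
      intro s j'
      rw [Matrix.add_vecMul, Matrix.smul_vecMul, Matrix.smul_vecMul, Matrix.single_one_vecMul]
      rfl
    -- Strict uniqueness persists under a small shift towards row `i`, so column `j` still attains
    -- the minimum; optimality of `x` then shows that row `i` cannot do better in column `j`.
    have hev : ∀ᶠ s in 𝓝[>] (0 : ℝ), ∀ j', (1 - s) * Matrix.vecMul x A j + s * A i j ≤
        (1 - s) * Matrix.vecMul x A j' + s * A i j' := by
      rw [eventually_all]
      intro j'
      rcases eq_or_ne j' j with rfl | h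
      · exact Eventually.of_forall fun s => le_rfl
      · have t : ∀ j'', Tendsto (fun s : ℝ => (1 - s) * Matrix.vecMul x A j'' + s * A i j'')
            (𝓝[>] 0) (𝓝 (Matrix.vecMul x A j'')) := by
          intro j''
          have : Tendsto (fun s : ℝ => (1 - s) * Matrix.vecMul x A j'' + s * A i j'') (𝓝 0)
              (𝓝 ((1 - 0) * Matrix.vecMul x A j'' + 0 * A i j'')) :=
            Continuous.tendsto (by fun_prop) 0
          rw [sub_zero, one_mul, zero_mul, add_zero] at this
          exact this.mono_left nhdsWithin_le_nhds
        exact ((t j).eventually_lt (t j') (huniq j' h)).mono fun s hs => hs.le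
    obtain ⟨s, hs, hs0, hs1⟩ := (hev.and (Ioo_mem_nhdsGT (zero_lt_one (α := ℝ)))).exists
    have hw := convex_stdSimplex ℝ (Fin n) hx (single_mem_stdSimplex ℝ i)
      (by linarith : 0 ≤ 1 - s) hs0.le (by ring)
    have h1 := hmax _ hw
    rw [hxj] at h1
    have h2 := (le_ciInf (fun j' => by rw [hcomb]; exact hs j')).trans h1
    nlinarith
  obtain ⟨i, hi⟩ : ∃ i, 0 < x i := by
    by_contra! h
    have := Finset.sum_nonpos fun i (_ : i ∈ Finset.univ) => h i
    rw [hx.2] at this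
    linarith
  -- Complementary slackness: every row in the support attains the maximum of column `j`, and
  -- without ties there is only one.
  have hzero : ∑ l, x l * (Matrix.vecMul x A j - A l j) = 0 := by
    simp only [mul_sub, Finset.sum_sub_distrib, ← Finset.sum_mul, hx.2, one_mul]
    exact sub_self _
  have hterm := (Finset.sum_eq_zero_iff_of_nonneg fun l _ =>
    mul_nonneg (hx.1 l) (sub_nonneg.2 (hle l))).1 hzero
  have heq : ∀ l, x l ≠ 0 → A l j = Matrix.vecMul x A j := fun l hl => by
    have := (mul_eq_zero.1 (hterm l (Finset.mem_univ l))).resolve_left hl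
    linarith
  have hoff : ∀ l, l ≠ i → x l = 0 := by
    intro l hl
    by_contra h
    exact hcol j l i hl ((heq l h).trans (heq i hi.ne').symm)
  have hxi : x = Pi.single i 1 := by
    have h1 : x i = 1 := by
      rw [← hx.2, Finset.sum_eq_single i (fun l _ hl => hoff l hl) (by simp)]
    ext l
    rcases eq_or_ne l i with rfl | hl
    · simp [h1]
    · simp [hl, hoff l hl]
  have hrow : ∀ j', Matrix.vecMul x A j' = A i j' := fun j' => by
    rw [hxi, Matrix.single_one_vecMul]; rfl
  refine ⟨i, fun i' => by rw [← hrow]; exact hle i', fun j' => ?_⟩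
  rcases eq_or_ne j' j with rfl | h
  · exact le_rfl
  · rw [← hrow, ← hrow]; exact (huniq j' h).le

/-- Outside the exceptional events, a game is good. -/
theorem goodGame_of_no_saddle (hn : 0 < n) (hm : 0 < m) (hA : ∀ i j, A i j ∈ Icc (-1 : ℝ) 1)
    (hgap : EntryGap A) (hcol : ∀ j i i', i ≠ i' → A i j ≠ A i' j)
    (hsaddle : ¬ ∃ i j, (∀ i', A i' j ≤ A i j) ∧ ∀ j', A i j ≤ A i j') : GoodGame A := by
  have : Nonempty (Fin m) := ⟨⟨0, hm⟩⟩
  obtain ⟨x, hx, hmax⟩ := exists_isMaxMin hn hm A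
  refine ⟨hA, hgap, x, hx, ?_⟩
  obtain ⟨j, hj⟩ := exists_eq_ciInf_of_finite (f := Matrix.vecMul x A)
  have hjb : j ∈ bestResp A x := mem_bestResp.2 fun j' => by
    rw [hj]; exact ciInf_le (Finite.bddBelow_range _) j'
  obtain ⟨j', hne, hj'⟩ : ∃ j', j' ≠ j ∧ Matrix.vecMul x A j' ≤ Matrix.vecMul x A j := by
    by_contra! h
    obtain ⟨i, hi⟩ := exists_saddle_of_unique_bestResp hx.1 hmax hcol h
    exact hsaddle ⟨i, j, hi⟩
  obtain ⟨l, hl⟩ : ∃ l, 0 < x l := by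
    by_contra! h
    have := Finset.sum_nonpos fun i (_ : i ∈ Finset.univ) => h i
    rw [hx.1.2] at this
    linarith
  refine ⟨j, hjb, j', mem_bestResp.2 fun l => hj'.trans (mem_bestResp.1 hjb l), l, hl, fun h => ?_⟩
  have h1 := hgap l j j' hne.symm
  rw [h, sub_self, abs_zero] at h1
  have : (0 : ℝ) < n := by exact_mod_cast hn
  have : (0 : ℝ) < m := by exact_mod_cast hm
  have : 0 < 2 / ((n : ℝ) ^ 2 * (m : ℝ) ^ 3) := by positivity
  linarith

end Existence

/-! ### Probability estimates for a uniform random game -/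

section UniformGame

open ProbabilityTheory

/-- The uniform distribution on `[-1, 1]`. -/
noncomputable def uniformEntry : Measure ℝ := ProbabilityTheory.cond volume (Icc (-1 : ℝ) 1)

instance : IsProbabilityMeasure uniformEntry :=
  cond_isProbabilityMeasure_of_finite (by simp) (by simp)

theorem uniformEntry_apply (s : Set ℝ) :
    uniformEntry s = 2⁻¹ * volume (Icc (-1 : ℝ) 1 ∩ s) := by
  rw [uniformEntry, cond_apply measurableSet_Icc, Real.volume_Icc]
  norm_num

theorem uniformEntry_le (s : Set ℝ) : uniformEntry s ≤ 2⁻¹ * volume s := by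
  rw [uniformEntry_apply]
  gcongr
  exact inter_subset_right

theorem uniformEntry_singleton (x : ℝ) : uniformEntry {x} = 0 :=
  le_antisymm ((uniformEntry_le _).trans (by simp)) zero_le

theorem uniformEntry_Icc_compl : uniformEntry (Icc (-1 : ℝ) 1)ᶜ = 0 := by
  rw [uniformEntry_apply]; simp

theorem lintegral_uniformEntry (f : ℝ → ENNReal) :
    ∫⁻ u, f u ∂uniformEntry = 2⁻¹ * ∫⁻ u in Icc (-1 : ℝ) 1, f u := by
  rw [uniformEntry, ProbabilityTheory.cond, lintegral_smul_measure, Real.volume_Icc]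
  norm_num

/-- Given one entry, the other must fall in an interval of length `2 g`, and the density is at most
`1/2`. -/
theorem uniformEntry_prod_abs_sub_lt {g : ℝ} :
    (uniformEntry.prod uniformEntry) {p : ℝ × ℝ | |p.1 - p.2| < g} ≤ ENNReal.ofReal g := by
  have hm : MeasurableSet {p : ℝ × ℝ | |p.1 - p.2| < g} :=
    (isOpen_lt (by fun_prop) (by fun_prop)).measurableSet
  rw [Measure.prod_apply hm]
  calc ∫⁻ u, uniformEntry (Prod.mk u ⁻¹' {p : ℝ × ℝ | |p.1 - p.2| < g}) ∂uniformEntry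
      ≤ ∫⁻ _u, ENNReal.ofReal g ∂uniformEntry := by
        refine lintegral_mono fun u => (uniformEntry_le _).trans ?_
        have : Prod.mk u ⁻¹' {p : ℝ × ℝ | |p.1 - p.2| < g} = Metric.ball u g := by
          ext v
          simp [Real.dist_eq, abs_sub_comm]
        rw [this, Real.volume_ball, ENNReal.ofReal_mul two_pos.le, ← mul_assoc]
        simp [ENNReal.inv_mul_cancel]
    _ = ENNReal.ofReal g := by simp

theorem uniformEntry_prod_diagonal :
    (uniformEntry.prod uniformEntry) {p : ℝ × ℝ | p.1 = p.2} = 0 := by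
  rw [Measure.prod_apply (isClosed_eq continuous_fst continuous_snd).measurableSet]
  have h : ∀ u : ℝ, Prod.mk u ⁻¹' {p : ℝ × ℝ | p.1 = p.2} = {u} := fun u => by
    ext v
    simp [eq_comm]
  simp only [h, uniformEntry_singleton, lintegral_zero]

/-- Two coordinates of a product measure with equal factors are independent. -/
theorem measurePreserving_eval_pair {ι Ω : Type*} [Fintype ι] [MeasurableSpace Ω]
    (ν : Measure Ω) [IsProbabilityMeasure ν] {i j : ι} (hij : i ≠ j) :
    MeasurePreserving (fun r : ι → Ω => (r i, r j)) (Measure.pi fun _ => ν) (ν.prod ν) := by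
  refine ⟨by fun_prop, ?_⟩
  have h := (iIndepFun_pi (μ := fun _ : ι => ν) (X := fun _ => id)
    (fun _ => aemeasurable_id)).indepFun hij
  simp only [id] at h
  rw [indepFun_iff_map_prod_eq_prod_map_map
    (measurable_pi_apply i).aemeasurable (measurable_pi_apply j).aemeasurable] at h
  rw [h]
  congr 1
  · exact (measurePreserving_eval (fun _ : ι => ν) i).map_eq
  · exact (measurePreserving_eval (fun _ : ι => ν) j).map_eq

/-- This is the normalization of the beta density, with the Gamma function at positive integers
written as factorials. -/
theorem lintegral_beta (a b : ℕ) :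
    ∫⁻ u in Ioo (0 : ℝ) 1, ENNReal.ofReal (u ^ a * (1 - u) ^ b) =
      ENNReal.ofReal ((a.factorial * b.factorial : ℕ) / ((a + b + 1).factorial : ℝ)) := by
  have h := lintegral_betaPDF_eq_one (α := (a : ℝ) + 1) (β := (b : ℝ) + 1)
    (by positivity) (by positivity)
  rw [lintegral_betaPDF] at h
  have hB : beta ((a : ℝ) + 1) ((b : ℝ) + 1) =
      (a.factorial * b.factorial : ℕ) / ((a + b + 1).factorial : ℝ) := by
    have e : (a : ℝ) + 1 + ((b : ℝ) + 1) = ((a + b + 1 : ℕ) : ℝ) + 1 := by push_cast; ring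
    rw [beta, e, Real.Gamma_nat_eq_factorial, Real.Gamma_nat_eq_factorial,
      Real.Gamma_nat_eq_factorial, Nat.cast_mul]
  have hpos := beta_pos (α := (a : ℝ) + 1) (β := (b : ℝ) + 1) (by positivity) (by positivity)
  simp only [add_sub_cancel_right, Real.rpow_natCast, mul_assoc] at h
  simp only [ENNReal.ofReal_mul (one_div_pos.2 hpos).le] at h
  rw [lintegral_const_mul' _ _ ENNReal.ofReal_ne_top, hB] at h
  rw [hB] at hpos
  set B : ℝ := (a.factorial * b.factorial : ℕ) / ((a + b + 1).factorial : ℝ)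
  have h2 : ENNReal.ofReal B * ENNReal.ofReal (1 / B) = 1 := by
    rw [← ENNReal.ofReal_mul hpos.le, mul_one_div_cancel hpos.ne', ENNReal.ofReal_one]
  calc _ = ENNReal.ofReal B * ENNReal.ofReal (1 / B) *
        ∫⁻ u in Ioo (0 : ℝ) 1, ENNReal.ofReal (u ^ a * (1 - u) ^ b) := by rw [h2, one_mul]
    _ = _ := by rw [mul_assoc, h, mul_one]

/-- Substituting `u = 2 s - 1`, so that `s` is the distribution function at `u`, reduces this to a
beta integral; the Jacobian `2` cancels the density `1/2`. -/
theorem lintegral_uniformEntry_pow (a b : ℕ) :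
    ∫⁻ u, uniformEntry (Iic u) ^ a * uniformEntry (Ici u) ^ b ∂uniformEntry =
      ENNReal.ofReal ((a.factorial * b.factorial : ℕ) / ((a + b + 1).factorial : ℝ)) := by
  have himg : (fun s : ℝ => 2 * s - 1) '' Ioo 0 1 = Ioo (-1) 1 := by
    ext u
    constructor
    · rintro ⟨s, ⟨h0, h1⟩, rfl⟩
      exact ⟨by linarith, by linarith⟩
    · rintro ⟨h0, h1⟩
      exact ⟨(1 + u) / 2, ⟨by linarith, by linarith⟩, by ring⟩
  have hderiv : ∀ s ∈ Ioo (0 : ℝ) 1,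
      HasDerivWithinAt (fun s : ℝ => 2 * s - 1) 2 (Ioo 0 1) s := fun s _ => by
    simpa using (((hasDerivAt_id s).const_mul 2).sub_const 1).hasDerivWithinAt
  rw [lintegral_uniformEntry, ← lintegral_beta, ← setLIntegral_congr Ioo_ae_eq_Icc, ← himg,
    lintegral_image_eq_lintegral_abs_deriv_mul measurableSet_Ioo hderiv
      (fun x _ y _ h => by simpa using h)]
  rw [← lintegral_const_mul' _ _ (by simp)]
  refine setLIntegral_congr_fun measurableSet_Ioo fun s ⟨h0, h1⟩ => ?_
  have e1 : uniformEntry (Iic (2 * s - 1)) = ENNReal.ofReal s := by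
    have : Icc (-1 : ℝ) 1 ∩ Iic (2 * s - 1) = Icc (-1) (2 * s - 1) := by
      ext x; simp only [mem_inter_iff, mem_Icc, mem_Iic]
      constructor
      · rintro ⟨⟨a, b⟩, c⟩; exact ⟨a, c⟩
      · rintro ⟨a, b⟩; exact ⟨⟨a, by linarith⟩, b⟩
    rw [uniformEntry_apply, this, Real.volume_Icc, sub_neg_eq_add, sub_add_cancel,
      ENNReal.ofReal_mul two_pos.le, ← mul_assoc]
    simp [ENNReal.inv_mul_cancel]
  have e2 : uniformEntry (Ici (2 * s - 1)) = ENNReal.ofReal (1 - s) := by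
    have : Icc (-1 : ℝ) 1 ∩ Ici (2 * s - 1) = Icc (2 * s - 1) 1 := by
      ext x; simp only [mem_inter_iff, mem_Icc, mem_Ici]
      constructor
      · rintro ⟨⟨a, b⟩, c⟩; exact ⟨c, b⟩
      · rintro ⟨a, b⟩; exact ⟨⟨by linarith, b⟩, a⟩
    have e : 1 - (2 * s - 1) = 2 * (1 - s) := by ring
    rw [uniformEntry_apply, this, Real.volume_Icc, e, ENNReal.ofReal_mul two_pos.le, ← mul_assoc]
    simp [ENNReal.inv_mul_cancel]
  have e3 : (2 : ENNReal)⁻¹ * ENNReal.ofReal |(2 : ℝ)| = 1 := by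
    simp [ENNReal.inv_mul_cancel]
  simp only [e1, e2]
  rw [← mul_assoc, e3, one_mul, ENNReal.ofReal_mul (by positivity), ENNReal.ofReal_pow h0.le,
    ENNReal.ofReal_pow (by linarith)]

/-- The law of one row. -/
noncomputable def uniformRow (m : ℕ) : Measure (Fin m → ℝ) := Measure.pi fun _ => uniformEntry

instance (m : ℕ) : IsProbabilityMeasure (uniformRow m) := by
  unfold uniformRow; infer_instance

theorem uniformGame_eq (n m : ℕ) : uniformGame n m = Measure.pi fun _ => uniformRow m := rfl

instance (n m : ℕ) : IsProbabilityMeasure (uniformGame n m) := by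
  rw [uniformGame_eq]; infer_instance

theorem uniformRow_eval_preimage {m : ℕ} (j : Fin m) (s : Set ℝ) (hs : MeasurableSet s) :
    uniformRow m {r | r j ∈ s} = uniformEntry s :=
  (measurePreserving_eval (fun _ : Fin m => uniformEntry) j).measure_preimage hs.nullMeasurableSet

theorem uniformGame_entry_notMem {n m : ℕ} (i : Fin n) (j : Fin m) :
    uniformGame n m {A | A i j ∉ Icc (-1 : ℝ) 1} = 0 := by
  have h := (measurePreserving_eval (fun _ : Fin n => uniformRow m) i).measure_preimage
    (s := {r | r j ∈ (Icc (-1 : ℝ) 1)ᶜ})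
    (measurable_pi_apply j measurableSet_Icc.compl).nullMeasurableSet
  rw [uniformRow_eval_preimage j _ measurableSet_Icc.compl, uniformEntry_Icc_compl] at h
  exact h

theorem uniformGame_abs_sub_lt {n m : ℕ} (l : Fin n) {i j : Fin m} (hij : i ≠ j) (g : ℝ) :
    uniformGame n m {A | |A l i - A l j| < g} ≤ ENNReal.ofReal g := by
  have hm : MeasurableSet {p : ℝ × ℝ | |p.1 - p.2| < g} :=
    (isOpen_lt (by fun_prop) (by fun_prop)).measurableSet
  have h := ((measurePreserving_eval_pair uniformEntry hij).comp
    (measurePreserving_eval (fun _ : Fin n => uniformRow m) l)).measure_preimage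
    hm.nullMeasurableSet
  exact h.le.trans uniformEntry_prod_abs_sub_lt

theorem uniformGame_column_tie {n m : ℕ} {i i' : Fin n} (hii : i ≠ i') (j : Fin m) :
    uniformGame n m {A | A i j = A i' j} = 0 := by
  have he := measurePreserving_eval (fun _ : Fin m => uniformEntry) j
  have h := ((he.prod he).comp
    (measurePreserving_eval_pair (uniformRow m) hii)).measure_preimage
    (isClosed_eq continuous_fst continuous_snd).measurableSet.nullMeasurableSet
  exact h.trans uniformEntry_prod_diagonal

theorem measurable_uniformEntry_Iic : Measurable fun u : ℝ => uniformEntry (Iic u) :=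
  Monotone.measurable fun _ _ h => measure_mono (Iic_subset_Iic.2 h)

/-- The probability that the entry `(i, j)` is a saddle point. -/
theorem uniformGame_saddle {n m : ℕ} (i : Fin (n + 1)) (j : Fin (m + 1)) :
    uniformGame (n + 1) (m + 1) {A | (∀ i', A i' j ≤ A i j) ∧ ∀ j', A i j ≤ A i j'} ≤
      ENNReal.ofReal ((n.factorial * m.factorial : ℕ) / ((n + m + 1).factorial : ℝ)) := by
  set T : Set ((Fin (m + 1) → ℝ) × (Fin n → Fin (m + 1) → ℝ)) :=
    {p | (∀ j', p.1 j ≤ p.1 j') ∧ ∀ k, p.2 k j ≤ p.1 j} with hT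
  have hTm : MeasurableSet T := by
    have h1 : IsClosed T := by
      simp only [hT, ofPred_and, ofPred_forall]
      refine IsClosed.inter (isClosed_iInter fun j' => isClosed_le (by fun_prop) (by fun_prop))
        (isClosed_iInter fun k => isClosed_le (by fun_prop) (by fun_prop))
    exact h1.measurableSet
  have h1 := (measurePreserving_piFinSuccAbove (fun _ : Fin (n + 1) => uniformRow (m + 1))
    i).measure_preimage hTm.nullMeasurableSet
  rw [Measure.prod_apply hTm] at h1
  set U : Set (ℝ × (Fin m → ℝ)) := {p | ∀ k, p.1 ≤ p.2 k} with hU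
  have hUm : MeasurableSet U := by
    have h1 : IsClosed U := by
      simp only [hU, ofPred_forall]
      exact isClosed_iInter fun j' => isClosed_le (by fun_prop) (by fun_prop)
    exact h1.measurableSet
  -- Given row `i`, the other rows matter only through column `j`, whose `n` remaining entries fall
  -- below the pivot independently. A second application of Fubini separates the pivot from the rest
  -- of its row.
  set F : ℝ × (Fin m → ℝ) → ENNReal := U.indicator fun p => uniformEntry (Iic p.1) ^ n with hF
  have hFm : Measurable F :=
    ((measurable_uniformEntry_Iic.comp measurable_fst).pow_const n).indicator hUm
  have h2 := (measurePreserving_piFinSuccAbove (fun _ : Fin (m + 1) => uniformEntry)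
    j).lintegral_comp hFm
  rw [lintegral_prod _ hFm.aemeasurable] at h2
  calc uniformGame (n + 1) (m + 1) {A | (∀ i', A i' j ≤ A i j) ∧ ∀ j', A i j ≤ A i j'}
      ≤ (Measure.pi fun _ : Fin (n + 1) => uniformRow (m + 1))
          (MeasurableEquiv.piFinSuccAbove (fun _ => Fin (m + 1) → ℝ) i ⁻¹' T) :=
        measure_mono fun A hA => ⟨hA.2, fun k => hA.1 _⟩
    _ = _ := h1
    _ ≤ ∫⁻ r, F (MeasurableEquiv.piFinSuccAbove (fun _ => ℝ) j r) ∂(uniformRow (m + 1)) := by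
        refine lintegral_mono fun r => ?_
        by_cases hr : ∀ j', r j ≤ r j'
        · have e : F (MeasurableEquiv.piFinSuccAbove (fun _ => ℝ) j r) =
              uniformEntry (Iic (r j)) ^ n :=
            indicator_of_mem (s := U) (fun k => hr _) _
          rw [e]
          refine (measure_mono (t := Set.pi univ fun _ => {R | R j ∈ Iic (r j)})
            fun R hR k _ => hR.2 k).trans ?_
          rw [Measure.pi_pi]
          simp only [uniformRow_eval_preimage j _ measurableSet_Iic, Finset.prod_const,
            Finset.card_univ, Fintype.card_fin, le_refl]
        · have : Prod.mk r ⁻¹' T = ∅ := eq_empty_of_forall_notMem fun R hR => hr hR.1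
          simp [this]
    _ = _ := h2
    _ = ∫⁻ u, uniformEntry (Iic u) ^ n * uniformEntry (Ici u) ^ m ∂uniformEntry := by
        refine lintegral_congr fun u => ?_
        have e : ∀ R : Fin m → ℝ, F (u, R) =
            (Set.pi univ fun _ => Ici u).indicator (fun _ => uniformEntry (Iic u) ^ n) R := by
          intro R
          simp only [hF, hU, indicator, mem_ofPred_eq, mem_univ_pi, mem_Ici]
        simp only [e]
        rw [lintegral_indicator_const (MeasurableSet.univ_pi fun _ => measurableSet_Ici),
          Measure.pi_pi]
        simp
    _ = _ := lintegral_uniformEntry_pow n m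

theorem uniformGame_not_goodGame {n m : ℕ} :
    uniformGame (n + 1) (m + 1) {A | ¬ GoodGame (Matrix.of A)} ≤
      ENNReal.ofReal ((((n + 1).factorial * (m + 1).factorial : ℕ) : ℝ) /
        ((n + 1 + (m + 1) - 1).factorial : ℝ) +
        1 / (((n + 1 : ℕ) : ℝ) * ((m + 1 : ℕ) : ℝ))) := by
  set g : ℝ := 2 / (((n + 1 : ℕ) : ℝ) ^ 2 * ((m + 1 : ℕ) : ℝ) ^ 3) with hg
  set μ := uniformGame (n + 1) (m + 1)
  set E1 : Set (Fin (n + 1) → Fin (m + 1) → ℝ) := ⋃ i, ⋃ j, {A | A i j ∉ Icc (-1 : ℝ) 1}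
  set E2 : Set (Fin (n + 1) → Fin (m + 1) → ℝ) :=
    ⋃ i, ⋃ i', ⋃ (_ : i ≠ i'), ⋃ j, {A | A i j = A i' j}
  set E3 : Set (Fin (n + 1) → Fin (m + 1) → ℝ) :=
    ⋃ i, ⋃ j, {A | (∀ i', A i' j ≤ A i j) ∧ ∀ j', A i j ≤ A i j'}
  -- Each unordered pair of columns is counted once; this saves the factor two needed to reach `1 /
  -- (n m)`.
  set E4 : Set (Fin (n + 1) → Fin (m + 1) → ℝ) :=
    ⋃ l, ⋃ j, ⋃ i ∈ Finset.Iio j, {A | |A l i - A l j| < g}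
  have hsub : {A | ¬ GoodGame (Matrix.of A)} ⊆ (E1 ∪ E2) ∪ (E3 ∪ E4) := by
    intro A hA
    by_contra hc
    simp only [E1, E2, E3, E4, mem_union, mem_iUnion, mem_ofPred_eq, not_or, not_exists,
      not_not, not_lt] at hc
    obtain ⟨⟨h1, h2⟩, h3, h4⟩ := hc
    refine hA (goodGame_of_no_saddle n.succ_pos m.succ_pos h1 ?_ (fun j i i' h => h2 i i' h j) ?_)
    · intro l i j hij
      rcases lt_or_gt_of_ne hij with h | h
      · exact h4 l j i (Finset.mem_Iio.2 h)
      · rw [abs_sub_comm]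
        exact h4 l i j (Finset.mem_Iio.2 h)
    · rintro ⟨i, j, h⟩
      exact h3 i j h
  have m1 : μ E1 = 0 := by
    simp only [E1, measure_iUnion_null_iff]
    exact fun i j => uniformGame_entry_notMem i j
  have m2 : μ E2 = 0 := by
    simp only [E2, measure_iUnion_null_iff]
    exact fun i i' h j => uniformGame_column_tie h j
  have m3 : μ E3 ≤ ENNReal.ofReal ((((n + 1).factorial * (m + 1).factorial : ℕ) : ℝ) /
        ((n + 1 + (m + 1) - 1).factorial : ℝ)) := by
    calc μ E3 ≤ ∑ i : Fin (n + 1), ∑ j : Fin (m + 1), ENNReal.ofReal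
          ((n.factorial * m.factorial : ℕ) / ((n + m + 1).factorial : ℝ)) :=
          (measure_iUnion_fintype_le _ _).trans (Finset.sum_le_sum fun i _ =>
            (measure_iUnion_fintype_le _ _).trans (Finset.sum_le_sum fun j _ =>
              uniformGame_saddle i j))
      _ = _ := by
        have e : n + 1 + (m + 1) - 1 = n + m + 1 := by omega
        simp only [Finset.sum_const, Finset.card_univ, Fintype.card_fin, nsmul_eq_mul, e]
        rw [← ENNReal.ofReal_natCast, ← ENNReal.ofReal_natCast (m + 1),
          ← ENNReal.ofReal_mul (by positivity), ← ENNReal.ofReal_mul (by positivity),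
          Nat.factorial_succ n, Nat.factorial_succ m]
        congr 1
        push_cast
        ring
  have m4 : μ E4 ≤ ENNReal.ofReal (1 / (((n + 1 : ℕ) : ℝ) * ((m + 1 : ℕ) : ℝ))) := by
    calc μ E4 ≤ ∑ l : Fin (n + 1), ∑ j : Fin (m + 1), ∑ i ∈ Finset.Iio j, ENNReal.ofReal g :=
          (measure_iUnion_fintype_le _ _).trans (Finset.sum_le_sum fun l _ =>
            (measure_iUnion_fintype_le _ _).trans (Finset.sum_le_sum fun j _ =>
              (measure_biUnion_finset_le _ _).trans (Finset.sum_le_sum fun i hi =>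
                uniformGame_abs_sub_lt l (Finset.mem_Iio.1 hi).ne g)))
      _ = ENNReal.ofReal (((n + 1 : ℕ) : ℝ) * ((∑ j ∈ Finset.range (m + 1), j : ℕ) * g)) := by
        simp only [Finset.sum_const, Finset.card_univ, Fintype.card_fin, nsmul_eq_mul,
          Fin.card_Iio, ← Finset.sum_mul]
        rw [Fin.sum_univ_eq_sum_range (fun j => (j : ENNReal)), ← Nat.cast_sum,
          ENNReal.ofReal_mul (by positivity), ENNReal.ofReal_mul (by positivity),
          ENNReal.ofReal_natCast, ENNReal.ofReal_natCast]
      _ ≤ _ := by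
        refine ENNReal.ofReal_le_ofReal ?_
        have h2 : ((∑ j ∈ Finset.range (m + 1), j : ℕ) : ℝ) * 2 ≤ ((m + 1 : ℕ) : ℝ) ^ 2 := by
          have := Finset.sum_range_id_mul_two (m + 1)
          rw [Nat.add_sub_cancel] at this
          have h3 : (∑ j ∈ Finset.range (m + 1), j) * 2 ≤ (m + 1) ^ 2 := by
            rw [this]; nlinarith
          exact_mod_cast h3
        have hn : (0 : ℝ) < ((n + 1 : ℕ) : ℝ) := by positivity
        have hm : (0 : ℝ) < ((m + 1 : ℕ) : ℝ) := by positivity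
        calc ((n + 1 : ℕ) : ℝ) * ((∑ j ∈ Finset.range (m + 1), j : ℕ) * g)
            = ((∑ j ∈ Finset.range (m + 1), j : ℕ) : ℝ) * 2 /
                (((n + 1 : ℕ) : ℝ) * ((m + 1 : ℕ) : ℝ) ^ 3) := by
              rw [hg]; field_simp
          _ ≤ ((m + 1 : ℕ) : ℝ) ^ 2 / (((n + 1 : ℕ) : ℝ) * ((m + 1 : ℕ) : ℝ) ^ 3) := by
              gcongr
          _ = _ := by field_simp
  calc μ {A | ¬ GoodGame (Matrix.of A)} ≤ μ ((E1 ∪ E2) ∪ (E3 ∪ E4)) := measure_mono hsub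
    _ ≤ (μ E1 + μ E2) + (μ E3 + μ E4) :=
        (measure_union_le _ _).trans (add_le_add (measure_union_le _ _) (measure_union_le _ _))
    _ ≤ _ := by
        rw [m1, m2, add_zero, zero_add, ENNReal.ofReal_add (by positivity) (by positivity)]
        exact add_le_add m3 m4

/-- The event `GoodGame` has high probability. -/
theorem le_uniformGame_goodGame (n : ℕ) {m : ℕ} (hm : 0 < m) :
    ENNReal.ofReal (1 - ((n.factorial * m.factorial : ℕ) : ℝ) / ((n + m - 1).factorial : ℝ)
        - 1 / ((n : ℝ) * (m : ℝ)))
      ≤ uniformGame n m {A | GoodGame (Matrix.of A)} := by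
  obtain ⟨m, rfl⟩ : ∃ k, m = k + 1 := ⟨m - 1, by omega⟩
  rcases n with _ | n
  · have : ((0 : ℕ).factorial * (m + 1).factorial : ℕ) / ((0 + (m + 1) - 1).factorial : ℝ) =
        (m : ℝ) + 1 := by
      have e : 0 + (m + 1) - 1 = m := by omega
      rw [e, Nat.factorial_zero, one_mul, Nat.factorial_succ, Nat.cast_mul,
        mul_div_cancel_right₀ _ (by positivity)]
      push_cast
      rfl
    rw [this, ENNReal.ofReal_of_nonpos]
    · exact zero_le
    · simp
  · have h := uniformGame_not_goodGame (n := n) (m := m)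
    -- Subadditivity suffices here, so measurability of the event is never required.
    have hu : 1 ≤ uniformGame (n + 1) (m + 1) {A | GoodGame (Matrix.of A)} +
        uniformGame (n + 1) (m + 1) {A | ¬ GoodGame (Matrix.of A)} := by
      rw [← measure_univ (μ := uniformGame (n + 1) (m + 1))]
      refine (measure_mono fun A _ => ?_).trans (measure_union_le _ _)
      exact em (GoodGame (Matrix.of A))
    rw [sub_sub, ENNReal.ofReal_sub _ (by positivity), ENNReal.ofReal_one, tsub_le_iff_right]
    exact hu.trans (add_le_add le_rfl h)

end UniformGame

/-! ### The main theorem -/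

theorem mainTheorem4 {n m : ℕ} (θ : ℝ → ℝ) (hθ : IsKernel θ)
    (N : Seminorm ℝ (Fin m → ℝ)) (hN : ∀ u, N u = 0 → u = 0)
    (α : ℝ) (hα : 0 < α) (hstrong : StronglyConvexWrt N α (sepReg θ))
    (δ : ℝ) (hδ0 : 0 < δ) (hδ1 : δ < 1 / (m : ℝ)) :
    -- the event has high probability
    ENNReal.ofReal (1 - ((n.factorial * m.factorial : ℕ) : ℝ) / ((n + m - 1).factorial : ℝ)
        - 1 / ((n : ℝ) * (m : ℝ)))
      ≤ uniformGame n m {A | GoodGame (Matrix.of A)} ∧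
    -- on the event, the price of precision is bounded below
    ∀ A : Matrix (Fin n) (Fin m) ℝ, GoodGame A →
      ∀ xs : stdSimplex ℝ (Fin n), IsMaxMin A xs → NonIdentified A xs →
        ∀ k : ℕ, k = (bestResp A xs).card → k < m →
          0 < gapMin A xs ∧ 0 < gameConst θ A xs δ ∧
          (∀ γ : ℝ, 0 < γ → γ < 2 →
            ((gameConst θ A xs δ / (2 * gapMin A xs) *
              (deriv θ ((1 - γ / 2) / k) - deriv θ (γ / (2 * ((m : ℝ) - k)))) : ℝ) : EReal)
              ≤ priceOfPrecision θ A xs (maxStep N α δ) γ) ∧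
          (∀ γ : ℝ, 0 < γ → γ < 2 →
            ((exploitRate n m θ δ / (2 * gapMin A xs) *
              (deriv θ ((1 - γ / 2) / k) - deriv θ (γ / 2)) : ℝ) : EReal)
              ≤ priceOfPrecision θ A xs (maxStep N α δ) γ) ∧
          ∃ c : ℝ, 0 < c ∧ ∀ᶠ γ in 𝓝[>] (0 : ℝ),
            ((c * (deriv θ (1 / (k : ℝ)) - deriv θ (γ / (2 * ((m : ℝ) - k)))) : ℝ) : EReal)
              ≤ priceOfPrecision θ A xs (maxStep N α δ) γ := by
  have hm : 0 < m := by
    by_contra! h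
    obtain rfl : m = 0 := by omega
    norm_num at hδ1
    linarith
  refine ⟨le_uniformGame_goodGame n hm, fun A hA xs hxs hni k hk hkm => ?_⟩
  obtain ⟨hmin, hconst, h1, h2⟩ :=
    priceOfPrecision_bounds hθ hN hα hstrong hδ0 hδ1 hA hxs hni hk hkm
  have hk2 : 2 ≤ k := by
    obtain ⟨i, hi, j, hj, l, -, hij⟩ := hni
    rw [hk]
    exact Finset.one_lt_card.2 ⟨i, hi, j, hj, by rintro rfl; exact hij rfl⟩
  have hmk : (1 : ℝ) ≤ (m : ℝ) - k := by
    have : (k : ℝ) + 1 ≤ m := by exact_mod_cast hkm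
    linarith
  have hK : 0 < gameConst θ A xs δ / (2 * gapMin A xs) := by positivity
  refine ⟨hmin, hconst, h1, h2, gameConst θ A xs δ / (2 * gapMin A xs) / 2, by positivity, ?_⟩
  filter_upwards [eventually_half_mul_le hθ hk2 hmk, Ioo_mem_nhdsGT (zero_lt_two (α := ℝ))]
    with γ hγ hγ2
  refine le_trans (EReal.coe_le_coe_iff.2 ?_) (h1 γ hγ2.1 hγ2.2)
  have := mul_le_mul_of_nonneg_left hγ hK.le
  linarith
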